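/- An effect algebra $(E;\oplus,0,1)$ is a set with distinct elements $0,1$ and a partial binary operation $\oplus$ that is commutative and associative (each equality holding as soon as one side is defined), such that for every $x$ there is a unique $x'$ with $x\oplus x'=1$, and such that $x=0$ whenever $1\oplus x$ is defined. Put $x\le y$ and $y\ominus x=z$ iff $x\oplus z=y$. All joins, meets and intervals refer to this order, and (complete) lattice effect algebras are those for which it is a (complete) lattice. $E$ is *Archimedean* if for every $x\neq 0$ some finite sum $x\oplus\cdots\oplus x$ is undefined; *atomic* if every nonzero element lies above a minimal nonzero element; *homogeneous* if $u\le v_1\oplus v_2\le u'$ implies $u=u_1\oplus u_2$ for some $u_1\le v_1$, $u_2\le v_2$; *orthocomplete* if, for every (bounded) family all of whose finite subfamilies have a defined orthosum, the set of these finite orthosums has a supremum. Let $\mathrm{Sh}(E)=\{x: x\wedge x'=0\}$ (sharp elements) and $\mathrm{Mea}(E)=\{x: s\in \mathrm{Sh}(E), s\le x\Rightarrow s=0\}$ (meager elements), each with the inherited partial operation ($x\oplus y$ is defined in the subset iff it is defined in $E$ and lies in the subset), and $h(s)=\{x\in \mathrm{Mea}(E): x\le s\}$ for $s\in\mathrm{Sh}(E)$.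 Write $\widetilde x$ and $\widehat x$ for the largest sharp element below $x$ and the smallest sharp element above $x$; $E$ is *sharply dominating* if $\widehat x$ exists for all $x$ (then so does $\widetilde x$). A *sub-effect algebra* is a subset $Q\ni 1$ such that whenever $x\oplus y=z$ and two of $x,y,z$ are in $Q$, so is the third; a *block* is a maximal sub-effect algebra having the Riesz decomposition property ($u\le v_1\oplus v_2$ implies $u=u_1\oplus u_2$ with $u_i\le v_i$). A *TRT-effect algebra* is a homogeneous sharply dominating effect algebra $E$ such that $[\widetilde x,x]\subseteq B$ for every block $B$ and $x\in B$, and such that for every $x\in\mathrm{Mea}(E)$ the element $y=\widehat x\ominus x$ is the only element of $E$ with: (i) $y\in\mathrm{Mea}(E)$ and $\widehat y=\widehat x$; (ii) $x\wedge y$ exists, and $x\oplus_{\mathrm{Mea}(E)}(y\ominus_{\mathrm{Mea}(E)}(x\wedge y))$ exists and belongs to $h(\widehat x)$; (iii) for all $z\in h(\widehat x)$: $z\oplus_{\mathrm{Mea}(E)}x$ exists and belongs to $h(\widehat x)$ iff $z\le y$ and $\widehat{y\ominus_{\mathrm{Mea}(E)} z}=\widehat x$. For $x,y\in\mathrm{Mea}(E)$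 let $S(x,y)$ be the greatest element, if there is one, of the set of all $z\in\mathrm{Sh}(E)$ for which $z\wedge x$ and $z\wedge y$ exist and $z=(z\wedge x)\oplus(z\wedge y)$. Let $\mathrm T(E)=\{(z_S,z_M)\in\mathrm{Sh}(E)\times\mathrm{Mea}(E): z_M\in h(z_S')\}$, where $(x_S,x_M)\oplus(y_S,y_M)$ is defined iff $s=S(x_M,y_M)$, $z_S=x_S\oplus y_S\oplus s$ in $\mathrm{Sh}(E)$ and $z_M=(x_M\ominus(s\wedge x_M))\oplus(y_M\ominus(s\wedge y_M))$ in $\mathrm{Mea}(E)$ are defined and $z_M\in h(z_S')$, and then it equals $(z_S,z_M)$. **Theorem.** Let $E$ be an effect algebra belonging to one of the following classes: (a) sharply dominating Archimedean atomic lattice effect algebras; (b) homogeneous orthocomplete effect algebras; (c) complete lattice effect algebras. Then: 1. $E$ is a TRT-effect algebra. 2. (Triple Representation Theorem for $E$.) $\mathrm T(E)$ with this operation, zero $(0,0)$ and unit $(1,0)$ is an effect algebra, and $x\mapsto(\widetilde x,x\ominus\widetilde x)$ is an isomorphism of effect algebras $E\to\mathrm T(E)$. Moreover the triple $(\mathrm{Sh}(E),\mathrm{Mea}(E),h)$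 characterizes $E$ up to isomorphism within the class of TRT-effect algebras: a TRT-effect algebra $F$ is isomorphic to $E$ if and only if there are isomorphisms of partial algebras $\alpha:\mathrm{Sh}(E)\to\mathrm{Sh}(F)$ (with $\alpha(1)=1$) and $\beta:\mathrm{Mea}(E)\to\mathrm{Mea}(F)$ with $\beta(h(s))=h(\alpha(s))$ for all $s\in\mathrm{Sh}(E)$. -/

import Mathlib

universe u v

/-- An effect algebra: a set with two distinct elements `0`, `1` and a partial binary operation
`⊕`. Here `oplus x y = some z` means that `x ⊕ y` is defined and equal to `z`, and
`oplus x y = none` means that `x ⊕ y` is not defined. -/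
class EffectAlgebra (E : Type u) extends Zero E, One E where
  oplus : E → E → Option E
  zero_ne_one : (0 : E) ≠ 1
  oplus_comm : ∀ x y : E, oplus x y = oplus y x
  oplus_assoc : ∀ x y z : E,
    (oplus x y).bind (fun a => oplus a z) = (oplus y z).bind (fun b => oplus x b)
  exists_unique_compl : ∀ x : E, ∃! y : E, oplus x y = some 1
  eq_zero_of_one_oplus : ∀ x y : E, oplus 1 x = some y → x = 0

namespace EffectAlgebra

section Basic

variable {E : Type u} [EffectAlgebra E]

/-- The orthosupplement `x'`, the unique element with `x ⊕ x' = 1`. -/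
noncomputable def compl (x : E) : E := (exists_unique_compl x).choose

theorem oplus_compl (x : E) : oplus x (compl x) = some 1 :=
  (exists_unique_compl x).choose_spec.1

theorem eq_compl {x y : E} (h : oplus x y = some 1) : y = compl x :=
  (exists_unique_compl x).choose_spec.2 y h

theorem assoc_right {x y z a w : E} (h1 : oplus x y = some a) (h2 : oplus a z = some w) :
    ∃ b, oplus y z = some b ∧ oplus x b = some w := by
  have h := oplus_assoc x y z
  rw [h1, Option.bind_some, h2] at h
  exact Option.bind_eq_some_iff.1 h.symm

theorem oplus_zero (x : E) : oplus x 0 = some x := by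
  have h1 : oplus (1 : E) 0 = some 1 := by
    obtain ⟨y, hy, -⟩ := exists_unique_compl (1 : E)
    have hy' : oplus (1 : E) y = some 1 := hy
    rwa [eq_zero_of_one_oplus y 1 hy'] at hy'
  have h2 : oplus (compl x) x = some 1 := by rw [oplus_comm]; exact oplus_compl x
  obtain ⟨b, hb, hb'⟩ := assoc_right h2 h1
  rw [hb, eq_compl hb', ← eq_compl h2]

theorem oplus_cancel {x y z w : E} (h1 : oplus x y = some w) (h2 : oplus x z = some w) :
    y = z := by
  rw [oplus_comm] at h1 h2
  obtain ⟨b, hb, hb'⟩ := assoc_right h1 (oplus_compl w)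
  obtain ⟨c, hc, hc'⟩ := assoc_right h2 (oplus_compl w)
  have hbc : b = c := Option.some.inj (hb.symm.trans hc)
  subst hbc
  rw [oplus_comm] at hb' hc'
  rw [eq_compl hb', eq_compl hc']

theorem eq_zero_of_oplus_eq_zero {x y : E} (h : oplus x y = some 0) : y = 0 := by
  have h1 : oplus (0 : E) 1 = some 1 := by rw [oplus_comm]; exact oplus_zero 1
  obtain ⟨b, hb, -⟩ := assoc_right h h1
  rw [oplus_comm] at hb
  exact eq_zero_of_one_oplus y b hb

theorem compl_compl (x : E) : compl (compl x) = x :=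
  (eq_compl (by rw [oplus_comm]; exact oplus_compl x)).symm

/-- The order of an effect algebra: `x ≤ y` iff `x ⊕ z = y` for some `z`
(this `z` is unique and is denoted `y ⊖ x`). -/
instance instPartialOrder : PartialOrder E where
  le x y := ∃ z, oplus x z = some y
  le_refl x := ⟨0, oplus_zero x⟩
  le_trans x y z := by
    rintro ⟨a, ha⟩ ⟨b, hb⟩
    obtain ⟨c, -, hc⟩ := assoc_right ha hb
    exact ⟨c, hc⟩
  le_antisymm x y := by
    rintro ⟨a, ha⟩ ⟨b, hb⟩
    obtain ⟨c, hc, hc'⟩ := assoc_right ha hb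
    have h0 : c = 0 := oplus_cancel hc' (oplus_zero x)
    subst h0
    have hb0 : b = 0 := eq_zero_of_oplus_eq_zero hc
    subst hb0
    exact Option.some.inj (hb.symm.trans (oplus_zero y))

end Basic

/-! ### Morphisms -/

/-- Morphisms of effect algebras preserve the unit and orthosums. -/
def IsMorphism {E : Type u} {F : Type v} [EffectAlgebra E] [EffectAlgebra F] (f : E → F) : Prop :=
  f 1 = 1 ∧ ∀ x y z : E, oplus x y = some z → oplus (f x) (f y) = some (f z)

/-- Isomorphisms are bijective morphisms whose inverse is a morphism. -/
def IsIsomorphism {E : Type u} {F : Type v} [EffectAlgebra E] [EffectAlgebra F] (e : E ≃ F) :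
    Prop :=
  IsMorphism e ∧ IsMorphism e.symm

section Classes

variable (E : Type u) [EffectAlgebra E]

/-! ### Lattice, Archimedean, atomic, homogeneous, orthocomplete effect algebras -/

/-- The order of `E` is a lattice. -/
def IsLatticeEA : Prop :=
  ∀ x y : E, (∃ m, IsGLB {x, y} m) ∧ (∃ j, IsLUB {x, y} j)

/-- The order of `E` is a complete lattice. -/
def IsCompleteLatticeEA : Prop :=
  ∀ A : Set E, (∃ m, IsGLB A m) ∧ (∃ j, IsLUB A j)

variable {E} in
/-- The sum `x₁ ⊕ ⋯ ⊕ xₙ = (x₁ ⊕ ⋯ ⊕ xₙ₋₁) ⊕ xₙ` of a finite sequence (`none` if it is not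
defined); the empty sum is `0`. -/
def listSum (l : List E) : Option E := l.foldlM (fun a x => oplus a x) 0

/-- `E` is Archimedean: for each nonzero `x` there is an `n` such that the `n`-fold sum
`x ⊕ ⋯ ⊕ x` is not defined. -/
def IsArchimedeanEA : Prop :=
  ∀ x : E, x ≠ 0 → ∃ n : ℕ, listSum (List.replicate n x) = none

/-- `E` is atomic: below each nonzero element there is an atom (a minimal nonzero element). -/
def IsAtomicEA : Prop :=
  ∀ x : E, x ≠ 0 → ∃ a : E, Minimal (fun y : E => y ≠ 0) a ∧ a ≤ x

/-- `E` is homogeneous: `u ≤ v₁ ⊕ v₂ ≤ u'` implies `u = u₁ ⊕ u₂` with `uᵢ ≤ vᵢ`. -/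
def IsHomogeneous : Prop :=
  ∀ u v₁ v₂ w : E, oplus v₁ v₂ = some w → u ≤ w → w ≤ compl u →
    ∃ u₁ u₂ : E, u₁ ≤ v₁ ∧ u₂ ≤ v₂ ∧ oplus u₁ u₂ = some u

variable {E} in
/-- `G^⊕`: the set of all sums over finite subsystems of the system `(x i)`; a finite subsystem
is given by a list of pairwise distinct indices. -/
def finiteSums {ι : Type u} (x : ι → E) : Set E :=
  {w | ∃ l : List ι, l.Nodup ∧ listSum (l.map x) = some w}

variable {E} in
/-- A system is orthogonal if the sum of each finite subsystem is defined. -/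
def IsOrthogonal {ι : Type u} (x : ι → E) : Prop :=
  ∀ l : List ι, l.Nodup → ∃ w, listSum (l.map x) = some w

/-- `E` is orthocomplete: each bounded orthogonal system is orthosummable, i.e. its finite sums
have a supremum. -/
def IsOrthocomplete : Prop :=
  ∀ (ι : Type u) (x : ι → E), IsOrthogonal x → BddAbove (finiteSums x) →
    ∃ w, IsLUB (finiteSums x) w

/-! ### Sharp and meager elements -/

/-- `Sh(E)`, the set of sharp elements: `x ∧ x' = 0`. -/
def Sh : Set E := {x | IsGLB {x, compl x} 0}

/-- `Mea(E)`, the set of meager elements: the only sharp element below `x` is `0`. -/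
def Mea : Set E := {x | ∀ s ∈ Sh E, s ≤ x → s = 0}

/-- `E` is sharply dominating: above each element there is a smallest sharp element. -/
def IsSharplyDominating : Prop :=
  ∀ x : E, ∃ t : E, IsLeast {s : E | s ∈ Sh E ∧ x ≤ s} t

end Classes

section Triple

variable {E : Type u} [EffectAlgebra E]

/-- `t` is `x̃`: the supremum of the sharp elements below `x` exists, is sharp, and equals `t`. -/
def IsTilde (x t : E) : Prop := t ∈ Sh E ∧ IsLUB {s : E | s ∈ Sh E ∧ s ≤ x} t

/-- `t` is `x̂`: the infimum of the sharp elements above `x` exists, is sharp, and equals `t`. -/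
def IsHat (x t : E) : Prop := t ∈ Sh E ∧ IsGLB {s : E | s ∈ Sh E ∧ x ≤ s} t

theorem compl_mem_Sh {x : E} (hx : x ∈ Sh E) : compl x ∈ Sh E := by
  change IsGLB {compl x, compl (compl x)} 0
  rw [compl_compl, Set.pair_comm]
  exact hx

/-- The sharp element `s'` for sharp `s`. -/
noncomputable def shCompl (s : Sh E) : Sh E := ⟨compl (s : E), compl_mem_Sh s.2⟩

/-- The map `h : Sh(E) → 2^Mea(E)`, `h(s) = {x ∈ Mea(E) | x ≤ s}`. -/
def h (s : Sh E) : Set (Mea E) := {x | (x : E) ≤ (s : E)}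

/-- `x ⊕ y = z` in the partial operation inherited by the subset `Q` (for `Q = Sh(E)` or
`Q = Mea(E)`): `x ⊕_Q y` is defined iff `x ⊕ y` is defined in `E` and belongs to `Q`. -/
def SubSum (Q : Set E) (x y z : Q) : Prop := oplus (x : E) (y : E) = some (z : E)

/-! ### Blocks and TRT-effect algebras -/

/-- Sub-effect algebras. -/
def IsSubEA (Q : Set E) : Prop :=
  1 ∈ Q ∧ ∀ x y z : E, oplus x y = some z →
    (x ∈ Q ∧ y ∈ Q ∨ x ∈ Q ∧ z ∈ Q ∨ y ∈ Q ∧ z ∈ Q) → x ∈ Q ∧ y ∈ Q ∧ z ∈ Q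

/-- The Riesz decomposition property of a sub-effect algebra `Q` with the inherited operation
(whose order is the restriction of that of `E`, as `Q` is closed under differences). -/
def HasRDP (Q : Set E) : Prop :=
  ∀ u ∈ Q, ∀ v₁ ∈ Q, ∀ v₂ ∈ Q, ∀ w ∈ Q, oplus v₁ v₂ = some w → u ≤ w →
    ∃ u₁ ∈ Q, ∃ u₂ ∈ Q, u₁ ≤ v₁ ∧ u₂ ≤ v₂ ∧ oplus u₁ u₂ = some u

/-- Blocks: the maximal sub-effect algebras with the Riesz decomposition property. -/
def IsBlock (B : Set E) : Prop := Maximal (fun Q : Set E => IsSubEA Q ∧ HasRDP Q) B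

/-- The three conditions on a meager element `y` relative to a meager `x` with `x̂ = t`:
(i) `ŷ = t`;
(ii) `x ⊕_Mea (y ⊖_Mea (x ∧ y))` exists and belongs to `h(t)`;
(iii) for all `z ∈ h(t)`: `z ⊕_Mea x` exists and belongs to `h(t)` iff `z ≤ y` and the hat of
`y ⊖_Mea z` is `t`. -/
structure TRTCondition (x : Mea E) (t : Sh E) (y : Mea E) : Prop where
  hat_eq : IsHat (y : E) (t : E)
  join_mem : ∃ m d w : Mea E, IsGLB {(x : E), (y : E)} (m : E) ∧ SubSum (Mea E) m d y ∧
    SubSum (Mea E) x d w ∧ w ∈ h t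
  sum_mem_iff : ∀ z ∈ h t, (∃ w : Mea E, SubSum (Mea E) z x w ∧ w ∈ h t) ↔
    ((z : E) ≤ (y : E) ∧ ∃ d : Mea E, SubSum (Mea E) z d y ∧ IsHat (d : E) (t : E))

variable (E) in
/-- TRT-effect algebras: homogeneous sharply dominating, `[x̃, x] ⊆ B` whenever `x` lies in the
block `B`, and for each meager `x` the element `x̂ ⊖ x` is the only `y ∈ E` which is meager
and satisfies the three conditions above. -/
structure IsTRT : Prop where
  homogeneous : IsHomogeneous E
  sharplyDominating : IsSharplyDominating E
  interval_subset : ∀ B : Set E, IsBlock B → ∀ x ∈ B, ∀ t : E, IsTilde x t → Set.Icc t x ⊆ B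
  unique_residual : ∀ (x : Mea E) (t : Sh E), IsHat (x : E) (t : E) →
    ∀ y : E, oplus (x : E) y = some (t : E) ↔ ∃ hy : y ∈ Mea E, TRTCondition x t ⟨y, hy⟩

/-! ### The algebra of pairs built from the triple -/

/-- `𝒮(x, y)`: the sharp `z` for which `z ∧ x` and `z ∧ y` exist and
`z = (z ∧ x) ⊕ (z ∧ y)`. -/
def sharpSplit (x y : Mea E) : Set E :=
  {z | z ∈ Sh E ∧ ∃ a b : E, IsGLB {z, (x : E)} a ∧ IsGLB {z, (y : E)} b ∧ oplus a b = some z}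

/-- `S(x, y)` is defined and equal to `s`: `s` is the top element of `𝒮(x, y)`. -/
def IsS (x y : Mea E) (s : Sh E) : Prop := IsGreatest (sharpSplit x y) (s : E)

variable (E) in
/-- The set `T(E)` of pairs `(z_S, z_M) ∈ Sh(E) × Mea(E)` with `z_M ∈ h(z_S')`. -/
structure Tea where
  sharp : Sh E
  meager : Mea E
  mem : meager ∈ h (shCompl sharp)

/-- `p ⊕ q` is defined in `T(E)` and equal to `r`: `s = S(p_M, q_M)` is defined,
`r_S = p_S ⊕ q_S ⊕ s` in `Sh(E)`, and
`r_M = (p_M ⊖ (s ∧ p_M)) ⊕ (q_M ⊖ (s ∧ q_M))` in `Mea(E)`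
(the remaining condition `r_M ∈ h(r_S')` is part of `r ∈ T(E)`). -/
def TeaSum (p q r : Tea E) : Prop :=
  ∃ s : Sh E, IsS p.meager q.meager s ∧
    (∃ k : Sh E, SubSum (Sh E) p.sharp q.sharp k ∧ SubSum (Sh E) k s r.sharp) ∧
    ∃ a b c d : Mea E, IsGLB {(s : E), (p.meager : E)} (a : E) ∧
      IsGLB {(s : E), (q.meager : E)} (b : E) ∧
      SubSum (Mea E) a c p.meager ∧ SubSum (Mea E) b d q.meager ∧
      SubSum (Mea E) c d r.meager

end Triple

/-- An isomorphism of the triples `(Sh, Mea, h)` of `E` and `F`: an isomorphism of `Sh(E)` onto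
`Sh(F)` and one of `Mea(E)` onto `Mea(F)`, both for the inherited partial operations (the first
preserving the unit), which carry the map `h` of `E` to that of `F`. -/
structure TripleIso (E : Type u) (F : Type v) [EffectAlgebra E] [EffectAlgebra F] where
  shEquiv : Sh E ≃ Sh F
  meaEquiv : Mea E ≃ Mea F
  map_one : ∀ s : Sh E, (s : E) = 1 → (shEquiv s : F) = 1
  sh_sum : ∀ x y z : Sh E,
    SubSum (Sh E) x y z ↔ SubSum (Sh F) (shEquiv x) (shEquiv y) (shEquiv z)
  mea_sum : ∀ x y z : Mea E,
    SubSum (Mea E) x y z ↔ SubSum (Mea F) (meaEquiv x) (meaEquiv y) (meaEquiv z)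
  map_h : ∀ s : Sh E, meaEquiv '' h s = h (shEquiv s)

end EffectAlgebra

/-! All three classes are treated through one set of axioms, `IsTame`: homogeneity, sharp
domination, maximal common lower bounds, and insertion of a sharp element between `u` and `x` when
`u ≤ x` is disjoint from `x'`. For Archimedean atomic lattices such sharp elements come from the
largest multiples of atoms (`exists_sharp_of_atom`). In the orthocomplete case they come from
maximal orthosums (`IsHomogeneous.exists_maximal_sum`). A complete lattice effect algebra is
homogeneous and orthocomplete.

Tame implies TRT. The main tool is `IsTame.split_of_floor_le`: whatever lies between `x̃` and `x`
splits along each decomposition of `x`. Hence intervals below meager elements have the Riesz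
property, and meager elements have meets. For the condition on blocks, `IsHomogeneous.isBlock_iff`
describes blocks as maximal internally compatible sets. Adjoining to a block the pieces into which
`x̃` cuts its elements below `x` preserves compatibility, so these pieces were already there
(`IsTame.floor_mem_of_maximal`). For the condition on residuals, a solution `y` and the true
residual share the part `y ⊖ (x ∧ y)`. Their remainders are orthogonal, have the same hat and the
same decompositions of the kind seen by (iii), and `IsTame.le_of_ceil_sub` then makes them equal.

In a TRT-effect algebra the sum `w` of two meager parts lies with them in a block, which contains
`w̃`. Splitting `w̃` there along the two summands gives its meets with them, so `S` is `w̃` and the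
operation of `T(E)` is that of `E` (`IsTRT.teaSum_of_add`). Finally the operation of `T(E)` depends
on the triple only. The one relation not visible in it, `a ⊕ b = z` with `a`, `b` meager and `z`
sharp, is recovered from the uniqueness of residuals (`IsTRT.mem_sharpSplit_iff`). -/

namespace EffectAlgebra

/-! ### Totalized addition and elementary arithmetic of effect algebras -/

section Total

/-- The elements of `E` together with an absorbing element `none`, on which the partial
operation of `E` becomes a total commutative one. -/
def Tot (E : Type u) : Type u := Option E

/-- The embedding of `E` into `Tot E`. -/
@[coe] def toTot {E : Type u} (x : E) : Tot E := some x

instance {E : Type u} : Coe E (Tot E) := ⟨toTot⟩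

theorem coe_inj {E : Type u} {x y : E} : (x : Tot E) = y ↔ x = y :=
  ⟨fun h => Option.some.inj h, fun h => h ▸ rfl⟩

variable {E : Type u} [EffectAlgebra E]

instance : Add (Tot E) :=
  ⟨fun a b => Option.bind a fun x => Option.bind b fun y => oplus x y⟩

instance : Zero (Tot E) := ⟨((0 : E) : Tot E)⟩

theorem coe_zero : ((0 : E) : Tot E) = 0 := rfl

theorem coe_add_eq_iff {x y z : E} : (x : Tot E) + y = z ↔ oplus x y = some z := Iff.rfl

instance : AddCommMonoid (Tot E) where
  add_assoc := by
    rintro (_ | x) (_ | y) (_ | z)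
    · rfl
    · rfl
    · rfl
    · rfl
    · rfl
    · rfl
    · change Option.bind (oplus x y) (fun _ => none) = none
      cases oplus x y <;> rfl
    · exact oplus_assoc x y z
  zero_add := by
    rintro (_ | x)
    · rfl
    · exact (oplus_comm 0 x).trans (oplus_zero x)
  add_zero := by
    rintro (_ | x)
    · rfl
    · exact oplus_zero x
  add_comm := by
    rintro (_ | x) (_ | y)
    · rfl
    · rfl
    · rfl
    · exact oplus_comm x y
  nsmul := nsmulRec

theorem defined_left {a b : Tot E} {z : E} (h : a + b = z) : ∃ x : E, a = x := by
  rcases a with _ | x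
  · cases h
  · exact ⟨x, rfl⟩

theorem defined_right {a b : Tot E} {z : E} (h : a + b = z) : ∃ x : E, b = x :=
  defined_left (add_comm a b ▸ h)

theorem tot_cancel {a b c : Tot E} {z : E} (h1 : a + b = z) (h2 : a + c = z) : b = c := by
  obtain ⟨x, rfl⟩ := defined_left h1
  obtain ⟨y, rfl⟩ := defined_right h1
  obtain ⟨w, rfl⟩ := defined_right h2
  exact congrArg _ (oplus_cancel (x := x) h1 h2)

theorem coe_cancel {a : Tot E} {x y z : E} (h1 : a + x = z) (h2 : a + y = z) : x = y :=
  coe_inj.1 (tot_cancel h1 h2)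

theorem le_iff {x y : E} : x ≤ y ↔ ∃ z : E, (x : Tot E) + z = y := Iff.rfl

theorem le_of_add {x z : E} {b : Tot E} (h : (x : Tot E) + b = z) : x ≤ z := by
  obtain ⟨y, rfl⟩ := defined_right h
  exact ⟨y, h⟩

theorem le_of_add' {x z : E} {b : Tot E} (h : b + (x : Tot E) = z) : x ≤ z :=
  le_of_add (add_comm b x ▸ h)

theorem zero_le (x : E) : 0 ≤ x := le_of_add (b := x) (by rw [coe_zero, zero_add])

theorem coe_add_compl (x : E) : (x : Tot E) + (compl x : E) = (1 : E) := oplus_compl x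

theorem le_one (x : E) : x ≤ 1 := le_of_add (coe_add_compl x)

theorem le_zero {x : E} (h : x ≤ 0) : x = 0 := le_antisymm h (zero_le x)

theorem eq_compl_of_add {x y : E} (h : (x : Tot E) + y = (1 : E)) : y = compl x := eq_compl h

theorem compl_zero : compl (0 : E) = 1 :=
  (eq_compl_of_add (by rw [coe_zero, zero_add])).symm

theorem compl_one : compl (1 : E) = 0 :=
  (eq_compl_of_add (by rw [coe_zero, add_zero])).symm

/-- Two elements are orthogonal if their sum is defined. -/
def Orth (x y : E) : Prop := ∃ z : E, (x : Tot E) + y = z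

theorem Orth.symm {x y : E} (h : Orth x y) : Orth y x := by
  obtain ⟨z, hz⟩ := h
  exact ⟨z, by rw [add_comm, hz]⟩

theorem le_compl_iff {x y : E} : x ≤ compl y ↔ Orth x y := by
  constructor
  · rintro ⟨z, hz⟩
    have h1 : (x : Tot E) + z = (compl y : E) := hz
    have h2 : (x : Tot E) + y + z = (1 : E) := by
      rw [← coe_add_compl y, ← h1]; abel
    exact defined_left h2
  · rintro ⟨z, hz⟩
    have h2 : (y : Tot E) + (x + (compl z : E)) = (1 : E) := by
      rw [← coe_add_compl z, ← hz]; abel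
    exact le_of_add (tot_cancel h2 (coe_add_compl y))

theorem compl_le_compl {x y : E} (h : x ≤ y) : compl y ≤ compl x := by
  obtain ⟨z, hz⟩ := h
  have hz : (x : Tot E) + z = y := hz
  have h2 : (x : Tot E) + ((compl y : E) + z) = (1 : E) := by
    rw [← coe_add_compl y, ← hz]; abel
  exact le_of_add (tot_cancel h2 (coe_add_compl x))

theorem le_compl_comm {x y : E} : x ≤ compl y ↔ y ≤ compl x := by
  rw [le_compl_iff, le_compl_iff]; exact ⟨Orth.symm, Orth.symm⟩

theorem compl_le_iff {x y : E} : compl x ≤ y ↔ compl y ≤ x := by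
  constructor <;> intro h <;> have := compl_le_compl h <;> rwa [compl_compl] at this

theorem Orth.mono {x y a b : E} (h : Orth x y) (hx : a ≤ x) (hy : b ≤ y) : Orth a b :=
  le_compl_iff.1 (hx.trans ((le_compl_iff.2 h).trans (compl_le_compl hy)))

theorem sum_le_sum {x y a b z w : E} (hx : a ≤ x) (hy : b ≤ y) (h1 : (a : Tot E) + b = w)
    (h2 : (x : Tot E) + y = z) : w ≤ z := by
  obtain ⟨p, hp⟩ := le_iff.1 hx
  obtain ⟨q, hq⟩ := le_iff.1 hy
  refine le_of_add (b := p + q) ?_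
  rw [← h1, ← h2, ← hp, ← hq]; abel

/-- If `a + b = z` and `a ≤ c ≤ z` then `c = a + d` with `d ≤ b`. -/
theorem exists_add_of_le_of_le {a b c z : E} (h : (a : Tot E) + b = z) (h1 : a ≤ c)
    (h2 : c ≤ z) : ∃ d : E, (a : Tot E) + d = c ∧ d ≤ b := by
  obtain ⟨d, hd⟩ := le_iff.1 h1
  obtain ⟨e, he⟩ := le_iff.1 h2
  refine ⟨d, hd, le_of_add (b := e) (tot_cancel (a := a) (z := z) ?_ h)⟩
  rw [← add_assoc, hd, he]

theorem le_of_add_le_add {a b c z w : E} (h1 : (a : Tot E) + b = z) (h2 : (a : Tot E) + c = w)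
    (h : z ≤ w) : b ≤ c := by
  obtain ⟨d, hd, hdc⟩ := exists_add_of_le_of_le h2 (le_of_add h1) h
  rwa [coe_cancel h1 hd]

/-- If `a + b = c + d` and `a ≤ c` then `d ≤ b`. -/
theorem le_of_add_eq_of_le {a b c d z : E} (h1 : (a : Tot E) + b = z)
    (h2 : (c : Tot E) + d = z) (h : a ≤ c) : d ≤ b := by
  obtain ⟨e, he⟩ := le_iff.1 h
  refine le_of_add' (b := e) (tot_cancel (a := a) (z := z) ?_ h1)
  rw [← add_assoc, he, h2]

theorem eq_zero_of_add_eq_self {a b : E} (h : (a : Tot E) + b = a) : b = 0 :=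
  coe_cancel h (by rw [coe_zero, add_zero])

/-- Two elements are disjoint if `0` is their only common lower bound. -/
def Disj (x y : E) : Prop := ∀ c, c ≤ x → c ≤ y → c = 0

theorem Disj.symm {x y : E} (h : Disj x y) : Disj y x := fun c h1 h2 => h c h2 h1

theorem Disj.mono {x y a b : E} (h : Disj x y) (hx : a ≤ x) (hy : b ≤ y) : Disj a b :=
  fun c h1 h2 => h c (h1.trans hx) (h2.trans hy)

theorem isGLB_pair_iff {x y m : E} :
    IsGLB {x, y} m ↔ (m ≤ x ∧ m ≤ y) ∧ ∀ c, c ≤ x → c ≤ y → c ≤ m := by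
  simp only [IsGLB, IsGreatest, lowerBounds_insert, lowerBounds_singleton, upperBounds,
    Set.mem_inter_iff, Set.mem_Iic, Set.mem_ofPred_eq, and_imp]

theorem mem_Sh_iff {x : E} : x ∈ Sh E ↔ Disj x (compl x) := by
  change IsGLB {x, compl x} 0 ↔ _
  rw [isGLB_pair_iff]
  exact ⟨fun h c h1 h2 => le_zero (h.2 c h1 h2),
    fun h => ⟨⟨zero_le _, zero_le _⟩, fun c h1 h2 => (h c h1 h2).le⟩⟩

theorem zero_mem_Sh : (0 : E) ∈ Sh E := mem_Sh_iff.2 fun _ h _ => le_zero h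

theorem one_mem_Sh : (1 : E) ∈ Sh E := by
  have := compl_mem_Sh (zero_mem_Sh (E := E))
  rwa [compl_zero] at this

theorem eq_zero_of_sharp {s c : E} (hs : s ∈ Sh E) (h1 : c ≤ s) (h2 : Orth c s) : c = 0 :=
  mem_Sh_iff.1 hs c h1 (le_compl_iff.2 h2)

theorem mea_of_le {x y : E} (hy : y ∈ Mea E) (h : x ≤ y) : x ∈ Mea E :=
  fun s hs hsx => hy s hs (hsx.trans h)

end Total

/-! ### Sharp and meager elements in homogeneous effect algebras -/

section Homogeneous

variable {E : Type u} [EffectAlgebra E]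

theorem IsHomogeneous.split (hH : IsHomogeneous E) {u a b w : E} (hw : (a : Tot E) + b = w)
    (hu : u ≤ w) (ho : Orth w u) : ∃ u₁ u₂ : E, u₁ ≤ a ∧ u₂ ≤ b ∧ (u₁ : Tot E) + u₂ = u :=
  hH u a b w hw hu (le_compl_iff.2 ho)

/-- The form in which homogeneity is mostly used: the summand of `u` below `a` is a common lower
bound of `u` and `a`, so it vanishes. -/
theorem IsHomogeneous.le_right (hH : IsHomogeneous E) {u a b w : E} (hw : (a : Tot E) + b = w)
    (hu : u ≤ w) (ho : Orth w u) (hd : Disj u a) : u ≤ b := by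
  obtain ⟨u₁, u₂, h1, h2, h3⟩ := hH.split hw hu ho
  have h0 : u₁ = 0 := hd u₁ (le_of_add h3) h1
  rw [h0, coe_zero, zero_add] at h3
  rwa [← coe_inj.1 h3]

theorem IsHomogeneous.eq_zero (hH : IsHomogeneous E) {u a b w : E} (hw : (a : Tot E) + b = w)
    (hu : u ≤ w) (ho : Orth w u) (ha : Disj u a) (hb : Disj u b) : u = 0 :=
  hb u le_rfl (hH.le_right hw hu ho ha)

/-- An element below both `z` and `z'` is disjoint from `x` and from `y`, because a part of it below
either one is also orthogonal to it. -/
theorem IsHomogeneous.add_mem_Sh (hH : IsHomogeneous E) {x y z : E} (hx : x ∈ Sh E)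
    (hy : y ∈ Sh E) (h : (x : Tot E) + y = z) : z ∈ Sh E := by
  refine mem_Sh_iff.2 fun c hc hc' => ?_
  have ho := le_compl_iff.1 hc'
  refine hH.eq_zero h hc ho.symm (fun d h1 h2 => ?_) (fun d h1 h2 => ?_)
  · exact eq_zero_of_sharp hx h2 (ho.mono h1 (le_of_add h))
  · exact eq_zero_of_sharp hy h2 (ho.mono h1 (le_of_add' h))

theorem IsHomogeneous.sub_mem_Sh (hH : IsHomogeneous E) {x y z : E} (hx : x ∈ Sh E)
    (hz : z ∈ Sh E) (h : (x : Tot E) + y = z) : y ∈ Sh E := by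
  have h1 : (x : Tot E) + (compl z : E) + y = (1 : E) := by
    rw [← coe_add_compl z, ← h]; abel
  obtain ⟨w, hw⟩ := defined_left h1
  rw [hw] at h1
  rw [eq_compl_of_add h1]
  exact compl_mem_Sh (hH.add_mem_Sh hx (compl_mem_Sh hz) hw)

/-- `t` is the largest sharp element below `x`. -/
def IsFloor (x t : E) : Prop := t ∈ Sh E ∧ t ≤ x ∧ ∀ s ∈ Sh E, s ≤ x → s ≤ t

/-- `t` is the smallest sharp element above `x`. -/
def IsCeil (x t : E) : Prop := t ∈ Sh E ∧ x ≤ t ∧ ∀ s ∈ Sh E, x ≤ s → t ≤ s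

theorem IsCeil.compl_isFloor {x t : E} (h : IsCeil x t) : IsFloor (compl x) (compl t) :=
  ⟨compl_mem_Sh h.1, compl_le_compl h.2.1, fun _ hs hsx =>
    le_compl_comm.1 (h.2.2 _ (compl_mem_Sh hs) (le_compl_comm.1 hsx))⟩

theorem IsFloor.compl_isCeil {x t : E} (h : IsFloor x t) : IsCeil (compl x) (compl t) :=
  ⟨compl_mem_Sh h.1, compl_le_compl h.2.1, fun _ hs hsx =>
    compl_le_iff.1 (h.2.2 _ (compl_mem_Sh hs) (compl_le_iff.1 hsx))⟩

theorem isSharplyDominating_iff : IsSharplyDominating E ↔ ∀ x : E, ∃ t, IsCeil x t :=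
  forall_congr' fun _ => exists_congr fun _ =>
    ⟨fun h => ⟨h.1.1, h.1.2, fun _ hs hx => h.2 ⟨hs, hx⟩⟩,
      fun h => ⟨⟨h.1, h.2.1⟩, fun _ hs => h.2.2 _ hs.1 hs.2⟩⟩

theorem IsSharplyDominating.exists_isCeil (hS : IsSharplyDominating E) (x : E) :
    ∃ t, IsCeil x t := isSharplyDominating_iff.1 hS x

theorem IsSharplyDominating.exists_isFloor (hS : IsSharplyDominating E) (x : E) :
    ∃ t, IsFloor x t := by
  obtain ⟨t, ht⟩ := hS.exists_isCeil (compl x)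
  exact ⟨compl t, by simpa only [compl_compl] using ht.compl_isFloor⟩

theorem IsFloor.eq {x s t : E} (h1 : IsFloor x s) (h2 : IsFloor x t) : s = t :=
  le_antisymm (h2.2.2 s h1.1 h1.2.1) (h1.2.2 t h2.1 h2.2.1)

theorem IsFloor.isTilde {x t : E} (h : IsFloor x t) : IsTilde x t :=
  ⟨h.1, fun _ hs => h.2.2 _ hs.1 hs.2, fun _ hb => hb ⟨h.1, h.2.1⟩⟩

theorem IsCeil.isHat {x t : E} (h : IsCeil x t) : IsHat x t :=
  ⟨h.1, fun _ hs => h.2.2 _ hs.1 hs.2, fun _ hb => hb ⟨h.1, h.2.1⟩⟩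

theorem IsSharplyDominating.isTilde_iff (hS : IsSharplyDominating E) {x t : E} :
    IsTilde x t ↔ IsFloor x t := by
  refine ⟨fun h => ?_, IsFloor.isTilde⟩
  obtain ⟨s, hs⟩ := hS.exists_isFloor x
  rwa [h.2.unique hs.isTilde.2]

theorem IsSharplyDominating.isHat_iff (hS : IsSharplyDominating E) {x t : E} :
    IsHat x t ↔ IsCeil x t := by
  refine ⟨fun h => ?_, IsCeil.isHat⟩
  obtain ⟨s, hs⟩ := hS.exists_isCeil x
  rwa [h.2.unique hs.isHat.2]

theorem IsHomogeneous.mea_of_isFloor (hH : IsHomogeneous E) {x t m : E} (h : IsFloor x t)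
    (hm : (t : Tot E) + m = x) : m ∈ Mea E := by
  intro s hs hsm
  obtain ⟨r, hr⟩ := le_iff.1 hsm
  have h1 : (t : Tot E) + s + r = x := by rw [← hm, ← hr]; abel
  obtain ⟨w, hw⟩ := defined_left h1
  rw [hw] at h1
  have h2 := h.2.2 w (hH.add_mem_Sh h.1 hs hw) (le_of_add h1)
  have h3 : w = t := le_antisymm h2 (le_of_add hw)
  rw [h3] at hw
  exact eq_zero_of_add_eq_self hw

theorem IsHomogeneous.isFloor_of_mea (hH : IsHomogeneous E) (hS : IsSharplyDominating E)
    {x t m : E} (ht : t ∈ Sh E) (hm : m ∈ Mea E) (h : (t : Tot E) + m = x) : IsFloor x t := by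
  obtain ⟨s, hs⟩ := hS.exists_isFloor x
  obtain ⟨d, hd, hdm⟩ := exists_add_of_le_of_le h (hs.2.2 t ht (le_of_add h)) hs.2.1
  have h0 : d = 0 := hm d (hH.sub_mem_Sh ht hs.1 hd) hdm
  rw [h0, coe_zero, add_zero] at hd
  rwa [coe_inj.1 hd]

/-- A nonzero sharp `s ≤ t ⊖ x` could be subtracted from `t`, leaving a smaller sharp element above
`x`. -/
theorem IsHomogeneous.mea_of_isCeil (hH : IsHomogeneous E) {x t y : E} (h : IsCeil x t)
    (hy : (x : Tot E) + y = t) : y ∈ Mea E := by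
  intro s hs hsy
  obtain ⟨r, hr⟩ := le_iff.1 hsy
  have h1 : (s : Tot E) + (x + r) = t := by rw [← hy, ← hr]; abel
  obtain ⟨w, hw⟩ := defined_right h1
  rw [hw] at h1
  have h2 := h.2.2 w (hH.sub_mem_Sh hs h.1 h1) (le_of_add hw)
  have h3 : w = t := le_antisymm (le_of_add' h1) h2
  rw [h3, add_comm] at h1
  exact eq_zero_of_add_eq_self h1

/-- The difference `t ⊖ ŷ` is sharp and below the meager `x`, hence zero. -/
theorem IsHomogeneous.isCeil_of_add (hH : IsHomogeneous E) (hS : IsSharplyDominating E)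
    {x t y : E} (ht : t ∈ Sh E) (hx : x ∈ Mea E) (h : (x : Tot E) + y = t) : IsCeil y t := by
  obtain ⟨s, hs⟩ := hS.exists_isCeil y
  obtain ⟨d, hd⟩ := le_iff.1 (hs.2.2 t ht (le_of_add' h))
  obtain ⟨e, he⟩ := le_iff.1 hs.2.1
  have h1 : (y : Tot E) + (e + d) = t := by rw [← hd, ← he]; abel
  have h2 : (e : Tot E) + d = x := tot_cancel h1 (by rw [add_comm, h])
  have h0 : d = 0 := hx d (hH.sub_mem_Sh hs.1 ht hd) (le_of_add' h2)
  rw [h0, coe_zero, add_zero] at hd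
  rwa [← coe_inj.1 hd]

end Homogeneous

/-! ### Splitting along decompositions, and uniqueness of residuals -/

section Tame

variable {E : Type u} [EffectAlgebra E]

variable (E) in
/-- Homogeneous sharply dominating effect algebras in which any two elements have a maximal
common lower bound `w` (so that the differences are disjoint) and in which a sharp element can be
inserted between `u` and `x` as soon as `u ≤ x` and `u` is disjoint from `x'`. -/
structure IsTame : Prop where
  hom : IsHomogeneous E
  sd : IsSharplyDominating E
  exists_disj : ∀ x y : E, ∃ w p q : E,
    (w : Tot E) + p = x ∧ (w : Tot E) + q = y ∧ Disj p q
  exists_sharp : ∀ u x : E, u ≤ x → Disj u (compl x) → ∃ s ∈ Sh E, u ≤ s ∧ s ≤ x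

/-- The core of `IsTame.split_of_floor_le`: `p` is the remainder of `v` once its common parts with
the two summands of `x` have been removed, and `q₁`, `q₂` are the remainders of the summands. -/
theorem IsTame.eq_zero_of_disj (hE : IsTame E) {x t v W Q q₁ q₂ p r : E} (ht : IsFloor x t)
    (htv : t ≤ v) (hWQ : (W : Tot E) + Q = x) (hWp : (W : Tot E) + p = v)
    (hq : (q₁ : Tot E) + q₂ = Q) (hpr : (p : Tot E) + r = Q) (h₁ : Disj p q₁)
    (h₂ : Disj p q₂) : p = 0 := by
  have hH := hE.hom
  have hvr : (v : Tot E) + r = x := by rw [← hWQ, ← hpr, ← hWp]; abel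
  have hr : r ∈ Mea E := by
    obtain ⟨m, hm⟩ := le_iff.1 ht.2.1
    exact mea_of_le (hH.mea_of_isFloor ht hm) (le_of_add_eq_of_le hm hvr htv)
  have hpQ : p ≤ Q := le_of_add hpr
  -- By homogeneity `p` is disjoint from `Q'`, so a sharp `s` fits between `p` and `Q`. As `s ≤ x̃ ≤
  -- v = W ⊕ p`, the excess of `s` over `p` lies below `W`, is therefore orthogonal to `s`, and
  -- vanishes.
  have hps : p ∈ Sh E := by
    obtain ⟨s, hs, hps, hsQ⟩ := hE.exists_sharp p Q hpQ fun c hc hc' =>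
      hH.eq_zero hq (hc.trans hpQ) (le_compl_iff.1 hc').symm (h₁.mono hc le_rfl)
        (h₂.mono hc le_rfl)
    have hsv : s ≤ v := (ht.2.2 s hs (hsQ.trans (le_of_add' hWQ))).trans htv
    obtain ⟨d, hd, hdW⟩ := exists_add_of_le_of_le (add_comm (W : Tot E) p ▸ hWp) hps hsv
    have h0 : d = 0 := eq_zero_of_sharp hs (le_of_add' hd)
      (Orth.mono ⟨x, hWQ⟩ hdW hsQ)
    rw [h0, coe_zero, add_zero] at hd
    rwa [coe_inj.1 hd]
  have hfl : IsFloor Q p := hH.isFloor_of_mea hE.sd hps hr hpr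
  -- A sharp element between `e` and `Q` lies below `Q̃ = p`, which is disjoint from `q₁`.
  have key : ∀ e, e ≤ q₁ → Disj e (compl Q) → e = 0 := by
    intro e he hd
    obtain ⟨s, hs, hes, hsQ⟩ := hE.exists_sharp e Q (he.trans (le_of_add hq)) hd
    exact h₁ e (hes.trans (hfl.2.2 s hs hsQ)) he
  -- The part `g` of `q₁` not shared with `r` will vanish by `key`. Then `q₁ ≤ r`, hence `p ≤ q₂`,
  -- which is disjoint from `p`.
  obtain ⟨w, g, r', hg, hr', hd⟩ := hE.exists_disj q₁ r
  have h1 : (w : Tot E) + (p + r') = Q := by rw [← hpr, ← hr']; abel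
  have h2 : (w : Tot E) + (g + q₂) = Q := by rw [← hq, ← hg]; abel
  obtain ⟨Q', hQ'⟩ := defined_right h1
  have h3 : (g : Tot E) + q₂ = Q' := (tot_cancel h2 h1).trans hQ'
  rw [hQ'] at h1
  have hg0 : g = 0 := by
    refine key g (le_of_add' hg) fun c hc hc' => ?_
    refine hH.eq_zero hQ' (hc.trans (le_of_add h3))
      ((le_compl_iff.1 hc').symm.mono (le_of_add' h1) le_rfl) ?_ (hd.mono hc le_rfl)
    exact h₁.symm.mono (hc.trans (le_of_add' hg)) le_rfl
  rw [hg0, coe_zero, add_zero] at hg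
  have hq1r : q₁ ≤ r := by rw [← coe_inj.1 hg]; exact le_of_add hr'
  exact h₂ p le_rfl (le_of_add_eq_of_le hq (by rw [add_comm, hpr]) hq1r)

/-- An element lying between `x̃` and `x` splits along each decomposition of `x`. -/
theorem IsTame.split_of_floor_le (hE : IsTame E) {x t v a b : E} (ht : IsFloor x t)
    (htv : t ≤ v) (hvx : v ≤ x) (hx : (a : Tot E) + b = x) :
    ∃ v₁ v₂ : E, v₁ ≤ a ∧ v₂ ≤ b ∧ (v₁ : Tot E) + v₂ = v ∧ ∀ s ∈ Sh E, s ≤ b → s ≤ v₂ := by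
  obtain ⟨s, hs⟩ := hE.sd.exists_isFloor b
  obtain ⟨v₀, hv₀⟩ := le_iff.1 ((ht.2.2 s hs.1 (hs.2.1.trans (le_of_add' hx))).trans htv)
  obtain ⟨b₀, hb₀⟩ := le_iff.1 hs.2.1
  -- The sharp part of `b` is set aside first, so that the second piece contains every sharp element
  -- below `b`. The rest of `v` is then compared with `b₀`, and what remains of it with `a`.
  obtain ⟨w₀, p₀, q₂, hp₀, hq₂, hd₂⟩ := hE.exists_disj v₀ b₀
  obtain ⟨w₁, p, q₁, hp, hq₁, hd₁⟩ := hE.exists_disj p₀ a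
  have h1 : (w₁ : Tot E) + (s + w₀) + p = v := by rw [← hv₀, ← hp₀, ← hp]; abel
  obtain ⟨W, hW⟩ := defined_left h1
  obtain ⟨w₂, hw₂⟩ := defined_right hW
  have h2 : (w₁ : Tot E) + (s + w₀) + (q₁ + q₂) = x := by
    rw [← hx, ← hb₀, ← hq₂, ← hq₁]; abel
  obtain ⟨Q, hQ⟩ := defined_right h2
  rw [hW] at h1 h2
  obtain ⟨r, hr⟩ := le_iff.1 hvx
  have hpr : (p : Tot E) + r = Q := by
    rw [← hQ]
    refine tot_cancel (a := W) (z := x) ?_ h2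
    rw [← add_assoc, h1, hr]
  have h0 : p = 0 := hE.eq_zero_of_disj ht htv (hQ ▸ h2) h1 hQ hpr hd₁
    (hd₂.mono (le_of_add' hp) le_rfl)
  rw [h0, coe_zero, add_zero] at h1
  rw [hw₂] at hW
  refine ⟨w₁, w₂, le_of_add hq₁, ?_, hW.trans h1, fun σ hσ hσb =>
    (hs.2.2 σ hσ hσb).trans (le_of_add hw₂)⟩
  refine le_of_add (b := q₂) ?_
  rw [← hw₂, ← hb₀, ← hq₂]; abel

theorem isFloor_zero_of_mea {x : E} (hx : x ∈ Mea E) : IsFloor x 0 :=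
  ⟨zero_mem_Sh, zero_le x, fun s hs h => (hx s hs h).le⟩

/-- Intervals below meager elements have the Riesz decomposition property. -/
theorem IsTame.split_of_mea (hE : IsTame E) {x v a b : E} (hm : x ∈ Mea E) (hv : v ≤ x)
    (hx : (a : Tot E) + b = x) : ∃ v₁ v₂ : E, v₁ ≤ a ∧ v₂ ≤ b ∧ (v₁ : Tot E) + v₂ = v := by
  obtain ⟨v₁, v₂, h1, h2, h3, -⟩ :=
    hE.split_of_floor_le (isFloor_zero_of_mea hm) (zero_le v) hv hx
  exact ⟨v₁, v₂, h1, h2, h3⟩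

/-- A maximal common lower bound `m` is the meet: a common lower bound splits along `x = m ⊕ a`, and
the Riesz property below `y` kills the part not covered by `m`, since `a` and `b` are disjoint. -/
theorem IsTame.exists_inf_of_mea (hE : IsTame E) {x y : E} (hx : x ∈ Mea E) (hy : y ∈ Mea E) :
    ∃ m a b : E, (m : Tot E) + a = x ∧ (m : Tot E) + b = y ∧ Disj a b ∧
      ∀ c, c ≤ x → c ≤ y → c ≤ m := by
  obtain ⟨m, a, b, ha, hb, hd⟩ := hE.exists_disj x y
  refine ⟨m, a, b, ha, hb, hd, fun z hzx hzy => ?_⟩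
  obtain ⟨p, r, hp, hr, hpr⟩ := hE.split_of_mea hx hzx ha
  obtain ⟨q, hq⟩ := le_iff.1 hp
  have h1 : (p : Tot E) + (q + b) = y := by rw [← hb, ← hq]; abel
  obtain ⟨y', hy'⟩ := defined_right h1
  rw [hy'] at h1
  have hry : r ≤ y' := le_of_add_le_add hpr h1 hzy
  obtain ⟨r₁, r₂, h2, h3, h4⟩ := hE.split_of_mea (mea_of_le hy (le_of_add' h1)) hry hy'
  have h0 : r₂ = 0 := hd r₂ ((le_of_add' h4).trans hr) h3
  rw [h0, coe_zero, add_zero] at h4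
  rw [← coe_inj.1 h4] at hpr
  exact sum_le_sum le_rfl h2 hpr hq

theorem IsTame.eq_zero_of_le_mea (hE : IsTame E) {x u : E} (hx : x ∈ Mea E) (hu : u ≤ x)
    (hd : ∀ c, c ≤ u → Orth c x → c = 0) : u = 0 := by
  obtain ⟨s, hs, hus, hsx⟩ := hE.exists_sharp u x hu fun c hc hc' => hd c hc (le_compl_iff.1 hc')
  exact le_zero (hus.trans (hx s hs hsx).le)

/-- Homogeneity makes `p` disjoint from `k'`, so a sharp element fits between `p` and `k`. Hence `p̂
≤ k`, and the excess of `p̂` over `p` lies below both `t` and `m`, so `p` is sharp. -/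
theorem IsTame.isFloor_sharp_part (hE : IsTame E) {t m a a' b' p q k : E} (ht : t ∈ Sh E)
    (hm : m ∈ Mea E) (htm : Orth t m) (ha : a ≤ t) (ha' : a' ≤ m) (hb' : b' ≤ m) (hpa : p ≤ a)
    (hp : (p : Tot E) + a' = k) (hq : (q : Tot E) + b' = k) (hd : Disj p q) : IsFloor k p := by
  have hpt := hpa.trans ha
  have hz : ∀ c, c ≤ t → c ≤ m → c = 0 := fun c h1 h2 =>
    eq_zero_of_sharp ht h1 (htm.symm.mono h2 le_rfl)
  obtain ⟨s, hs, hps, hsk⟩ := hE.exists_sharp p k (le_of_add hp) fun f hf hf' =>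
    hE.hom.eq_zero hq (hf.trans (le_of_add hp)) (le_compl_iff.1 hf').symm (hd.mono hf le_rfl)
      fun e h1 h2 => hz e (h1.trans (hf.trans hpt)) (h2.trans hb')
  obtain ⟨σ, hσ⟩ := hE.sd.exists_isCeil p
  obtain ⟨d, h1, h2⟩ := exists_add_of_le_of_le hp hσ.2.1 ((hσ.2.2 s hs hps).trans hsk)
  have h0 : d = 0 := hz d ((le_of_add' h1).trans (hσ.2.2 t ht hpt)) (h2.trans ha')
  rw [h0, coe_zero, add_zero] at h1
  have hpS : p ∈ Sh E := by rw [coe_inj.1 h1]; exact hσ.1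
  exact hE.hom.isFloor_of_mea hE.sd hpS (mea_of_le hm ha') hp

/-- The decomposition of an element into a part below a sharp `t` and a part below a meager `m`
orthogonal to `t` is unique. -/
theorem IsTame.sharp_part_unique (hE : IsTame E) {t m a a' b b' c : E} (ht : t ∈ Sh E)
    (hm : m ∈ Mea E) (htm : Orth t m) (ha : a ≤ t) (ha' : a' ≤ m) (hb : b ≤ t) (hb' : b' ≤ m)
    (h1 : (a : Tot E) + a' = c) (h2 : (b : Tot E) + b' = c) : a = b := by
  obtain ⟨w, p, q, hp, hq, hd⟩ := hE.exists_disj a b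
  have h3 : (w : Tot E) + (p + a') = c := by rw [← h1, ← hp]; abel
  have h4 : (w : Tot E) + (q + b') = c := by rw [← h2, ← hq]; abel
  obtain ⟨k, hk⟩ := defined_right h3
  have hk' := (tot_cancel h4 h3).trans hk
  have hfp := hE.isFloor_sharp_part ht hm htm ha ha' hb' (le_of_add' hp) hk hk' hd
  have hfq := hE.isFloor_sharp_part ht hm htm hb hb' ha' (le_of_add' hq) hk' hk hd.symm
  rw [hfq.eq hfp, hp] at hq
  exact coe_inj.1 hq

/-- By homogeneity `c` is disjoint from `n' = s' ⊕ e`, so a sharp `σ` fits between `c` and `n`. Now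
`s ⊖ σ` is a sharp element above `e`, and minimality of `s` gives `σ = 0`. -/
theorem IsTame.eq_zero_of_le_ceil_sub (hE : IsTame E) {e n s c : E} (hs : IsCeil e s)
    (hn : (e : Tot E) + n = s) (hc : c ≤ n) (hd : Disj c e) : c = 0 := by
  have hne : (n : Tot E) + ((compl s : E) + e) = (1 : E) := by
    rw [← coe_add_compl s, ← hn]; abel
  have h1 : ((compl s : E) : Tot E) + e = (compl n : E) := tot_cancel hne (coe_add_compl n)
  obtain ⟨σ, hσ, hcσ, hσn⟩ := hE.exists_sharp c n hc fun f hf hf' => by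
    refine hd f hf (hE.hom.le_right h1 hf' ?_ fun g hg hg' => ?_)
    · exact (le_compl_iff.1 (le_refl (compl n))).mono le_rfl (hf.trans hc)
    · exact eq_zero_of_sharp hs.1 ((hg.trans hf).trans (hc.trans (le_of_add' hn)))
        (le_compl_iff.1 hg')
  obtain ⟨ρ, hρ⟩ := le_iff.1 (hσn.trans (le_of_add' hn))
  have h2 : e ≤ ρ := le_of_add_eq_of_le hρ (by rw [add_comm, hn]) hσn
  have h3 : ρ = s := le_antisymm (le_of_add' hρ) (hs.2.2 ρ (hE.hom.sub_mem_Sh hσ hs.1 hρ) h2)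
  rw [h3, add_comm] at hρ
  exact le_zero (hcσ.trans (eq_zero_of_add_eq_self hρ).le)

/-- Split `w̃` along `x ⊕ d`. A part of the first piece orthogonal to `x` lies below `y`, hence
below `m`, which is orthogonal to `w`; so the first piece vanishes and `w̃ ≤ y` is zero. -/
theorem IsTame.join_mem_Mea (hE : IsTame E) {x y t m d w : E} (hx : x ∈ Mea E) (hy : y ∈ Mea E)
    (ht : (x : Tot E) + y = t) (hts : t ∈ Sh E) (hm : ∀ c, c ≤ x → c ≤ y → c ≤ m)
    (hd : (m : Tot E) + d = y) (hw : (x : Tot E) + d = w) : w ∈ Mea E := by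
  obtain ⟨s, hs⟩ := hE.sd.exists_isFloor w
  obtain ⟨s₁, s₂, h1, h2, h3, -⟩ := hE.split_of_floor_le hs le_rfl hs.2.1 hw
  have hwm : (w : Tot E) + m = t := by rw [← ht, ← hd, ← hw]; abel
  have h0 : s₁ = 0 := by
    refine hE.eq_zero_of_le_mea hx h1 fun c hc hcx => ?_
    have h4 : ((compl t : E) : Tot E) + y = (compl x : E) := by
      refine tot_cancel (a := x) (z := 1) ?_ (coe_add_compl x)
      rw [← coe_add_compl t, ← ht]; abel
    have hcy : c ≤ y := hE.hom.le_right h4 (le_compl_iff.2 hcx)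
      ((le_compl_iff.1 (le_refl (compl x))).mono le_rfl (hc.trans h1))
      fun e he he' => eq_zero_of_sharp hts (he.trans ((hc.trans h1).trans (le_of_add ht)))
        (le_compl_iff.1 he')
    exact eq_zero_of_sharp hs.1 (hc.trans (le_of_add h3))
      (Orth.mono ⟨t, by rw [add_comm, hwm]⟩ (hm c (hc.trans h1) hcy) hs.2.1)
  rw [h0, coe_zero, zero_add] at h3
  have hs0 : s = 0 := by
    rw [coe_inj.1 h3] at h2
    exact hy s hs.1 (h2.trans (le_of_add' hd))
  exact fun σ hσ hσw => le_zero ((hs.2.2 σ hσ hσw).trans hs0.le)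

theorem IsTame.trtCondition_of_add (hE : IsTame E) {x y : Mea E} {t : Sh E} (hy : ((x : E) : Tot E) + (y : E) = (t : E)) :
    TRTCondition x t y where
  hat_eq := (hE.hom.isCeil_of_add hE.sd t.2 x.2 hy).isHat
  join_mem := by
    obtain ⟨m, a, d, ha, hd, -, hm⟩ := hE.exists_inf_of_mea x.2 y.2
    have h1 : (m : Tot E) + ((x : E) + d) = (t : E) := by rw [← hy, ← hd]; abel
    obtain ⟨w, hw⟩ := defined_right h1
    rw [hw] at h1
    exact ⟨⟨m, mea_of_le x.2 (le_of_add ha)⟩, ⟨d, mea_of_le y.2 (le_of_add' hd)⟩,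
      ⟨w, hE.join_mem_Mea x.2 y.2 hy t.2 hm hd hw⟩,
      isGLB_pair_iff.2 ⟨⟨le_of_add ha, le_of_add hd⟩, hm⟩, hd, hw, le_of_add' h1⟩
  sum_mem_iff := by
    intro z _
    constructor
    · rintro ⟨w, hw, hwt⟩
      have hw : ((z : E) : Tot E) + (x : E) = (w : E) := hw
      obtain ⟨d, hd⟩ := le_iff.1 (show (w : E) ≤ t from hwt)
      have h1 : ((z : E) : Tot E) + d = (y : E) := by
        refine tot_cancel (a := (x : E)) (z := (t : E)) ?_ hy
        rw [← hd, ← hw]; abel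
      exact ⟨le_of_add h1, ⟨d, mea_of_le y.2 (le_of_add' h1)⟩, h1,
        (hE.hom.isCeil_of_add hE.sd t.2 w.2 hd).isHat⟩
    · rintro ⟨-, d, hd, hdt⟩
      have hd : ((z : E) : Tot E) + (d : E) = (y : E) := hd
      have h1 : ((d : E) : Tot E) + ((z : E) + (x : E)) = (t : E) := by rw [← hy, ← hd]; abel
      obtain ⟨w, hw⟩ := defined_right h1
      rw [hw] at h1
      exact ⟨⟨w, hE.hom.mea_of_isCeil (hE.sd.isHat_iff.1 hdt) h1⟩, hw, le_of_add' h1⟩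

/-- With `k = m ∧ r` and `m = k ⊕ e`, the aim is `e = 0`. Some `g ≤ k` is chosen so that `m ⊖ g`
still has hat `t` whereas `r ⊖ g` lies below the complement of `ê`. -/
theorem IsTame.le_of_ceil_sub (hE : IsTame E) {m r t : E} (hm : m ∈ Mea E) (hr : r ∈ Mea E)
    (hmt : IsCeil m t) (ho : Orth m r)
    (H : ∀ g d : E, (g : Tot E) + d = m → IsCeil d t →
      ∃ d' : E, (g : Tot E) + d' = r ∧ IsCeil d' t) : m ≤ r := by
  obtain ⟨k, e, f, he, hf, hd, -⟩ := hE.exists_inf_of_mea hm hr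
  obtain ⟨s, hs⟩ := hE.sd.exists_isCeil e
  have hem : e ≤ m := le_of_add' he
  have hst : s ≤ t := hs.2.2 t hmt.1 (hem.trans hmt.2.1)
  obtain ⟨n, hn⟩ := le_iff.1 hs.2.1
  obtain ⟨l, hl⟩ := le_iff.1 (le_compl_iff.2 (ho.symm.mono le_rfl hem))
  have hfl := hs.compl_isFloor
  obtain ⟨u₁, u₂, h1, h2, h3, -⟩ := hE.split_of_floor_le hfl le_rfl hfl.2.1 hl
  obtain ⟨g, hg⟩ := le_iff.1 h1
  obtain ⟨j, hj⟩ := le_iff.1 h2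
  -- Here `u₁ ⊕ u₂` is `s'`, the largest sharp element below `e' = r ⊕ l`, and `g = r ⊖ u₁`.
  -- Comparing decompositions of the unit gives `g ⊕ j = s ⊖ e`.
  have hgn : g ≤ n := by
    refine le_of_add (b := j) (tot_cancel (a := (e : Tot E) + ((compl s : E) : Tot E)) (z := 1) ?_ ?_)
    · rw [← coe_add_compl e, ← hl, ← hg, ← hj, ← h3]; abel
    · rw [← coe_add_compl s, ← hn]; abel
  obtain ⟨g₁, g₂, h4, h5, h6⟩ := hE.split_of_mea hr (le_of_add' hg) hf
  have h0 : g₂ = 0 := hE.eq_zero_of_le_ceil_sub hs hn ((le_of_add' h6).trans hgn)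
    (hd.symm.mono h5 le_rfl)
  rw [h0, coe_zero, add_zero] at h6
  rw [coe_inj.1 h6] at h4
  obtain ⟨k', hk'⟩ := le_iff.1 h4
  have h7 : (g : Tot E) + (k' + e) = m := by rw [← he, ← hk']; abel
  obtain ⟨d, hkd⟩ := defined_right h7
  rw [hkd] at h7
  -- The complement of `d̂` splits along `d' = g ⊕ m'`; the part below `g ≤ s ≤ d̂` is zero, so `m ≤
  -- d̂`.
  have hdt : IsCeil d t := by
    obtain ⟨σ, hσ⟩ := hE.sd.exists_isCeil d
    have hsσ : s ≤ σ := hs.2.2 σ hσ.1 ((le_of_add' hkd).trans hσ.2.1)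
    have hfσ := hσ.compl_isFloor
    have h8 : (g : Tot E) + (compl m : E) = (compl d : E) := by
      refine tot_cancel (a := d) (z := 1) ?_ (coe_add_compl d)
      rw [← coe_add_compl m, ← h7]; abel
    obtain ⟨σ₁, σ₂, h9, h10, h11, -⟩ := hE.split_of_floor_le hfσ le_rfl hfσ.2.1 h8
    have h12 : σ₁ = 0 := eq_zero_of_sharp hσ.1
      (h9.trans (hgn.trans ((le_of_add' hn).trans hsσ))) (le_compl_iff.1 (le_of_add h11))
    rw [h12, coe_zero, zero_add] at h11
    rw [coe_inj.1 h11] at h10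
    have h13 : m ≤ σ := by
      have := compl_le_compl h10
      rwa [compl_compl, compl_compl] at this
    rwa [le_antisymm (hmt.2.2 σ hσ.1 h13)
      (hσ.2.2 t hmt.1 ((le_of_add' h7).trans hmt.2.1))]
  obtain ⟨d', hd', hdt'⟩ := H g d h7 hdt
  have h14 : d' = u₁ := coe_cancel hd' (by rw [add_comm, hg])
  -- Since `r ⊖ g = u₁ ≤ s'` has hat `t`, the chain `s ≤ t ≤ s'` forces the sharp `s = ê` to be
  -- zero.
  have h15 : t ≤ compl s := hdt'.2.2 _ hfl.1 (h14.le.trans (le_of_add h3))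
  have h16 : s = 0 := eq_zero_of_sharp hs.1 le_rfl (le_compl_iff.1 (hst.trans h15))
  have h17 : e = 0 := le_zero (hs.2.1.trans h16.le)
  rw [h17, coe_zero, add_zero] at he
  rw [← coe_inj.1 he]
  exact le_of_add hf

/-- By (iii), both sides say that `z ⊕ g ⊕ x` is a meager element below `t`, a statement which
involves neither `y` nor `y'`. -/
theorem IsTame.exists_ceil_sub (hE : IsTame E) {x y y' : Mea E} {t : Sh E}
    (hy : TRTCondition x t y) (hy' : TRTCondition x t y') {z m r g d : E}
    (hm : (z : Tot E) + m = (y : E)) (hr : (z : Tot E) + r = (y' : E))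
    (hg : (g : Tot E) + d = m) (hd : IsCeil d (t : E)) :
    ∃ d' : E, (g : Tot E) + d' = r ∧ IsCeil d' (t : E) := by
  have h1 : (z : Tot E) + g + d = (y : E) := by rw [← hm, ← hg]; abel
  obtain ⟨k, hk⟩ := defined_left h1
  rw [hk] at h1
  have hkm : k ∈ Mea E := mea_of_le y.2 (le_of_add h1)
  have hkt : (⟨k, hkm⟩ : Mea E) ∈ h t :=
    (le_of_add h1).trans (hE.sd.isHat_iff.1 hy.hat_eq).2.1
  have h2 := (hy.sum_mem_iff ⟨k, hkm⟩ hkt).2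
    ⟨le_of_add h1, ⟨d, mea_of_le y.2 (le_of_add' h1)⟩, h1, hd.isHat⟩
  obtain ⟨-, d', hd', hdt⟩ := (hy'.sum_mem_iff ⟨k, hkm⟩ hkt).1 h2
  have hd' : (k : Tot E) + (d' : E) = (y' : E) := hd'
  refine ⟨d', tot_cancel (a := z) (z := (y' : E)) ?_ hr, hE.sd.isHat_iff.1 hdt⟩
  rw [← hd', ← hk, add_assoc]

theorem IsTame.add_of_trtCondition (hE : IsTame E) {x y : Mea E} {t : Sh E}
    (ht : IsCeil (x : E) (t : E)) (hy : TRTCondition x t y) :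
    ((x : E) : Tot E) + (y : E) = (t : E) := by
  obtain ⟨y₀, hy₀⟩ := le_iff.1 ht.2.1
  have hy₀m : y₀ ∈ Mea E := hE.hom.mea_of_isCeil ht hy₀
  have h₀ := hE.trtCondition_of_add (y := ⟨y₀, hy₀m⟩) hy₀
  obtain ⟨m, z, w, hmx, hz, hw, hwt⟩ := hy.join_mem
  have hz : ((m : E) : Tot E) + (z : E) = (y : E) := hz
  have hw : ((x : E) : Tot E) + (z : E) = (w : E) := hw
  have hyt : (y : E) ≤ t := (hE.sd.isHat_iff.1 hy.hat_eq).2.1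
  have hzt : z ∈ h t := (le_of_add' hz).trans hyt
  have hzx : ∃ w : Mea E, SubSum (Mea E) z x w ∧ w ∈ h t :=
    ⟨w, by rw [add_comm] at hw; exact hw, hwt⟩
  obtain ⟨-, m', hm', hmt⟩ := (hy.sum_mem_iff z hzt).1 hzx
  obtain ⟨-, r, hr, hrt⟩ := (h₀.sum_mem_iff z hzt).1 hzx
  have hm' : ((z : E) : Tot E) + (m' : E) = (y : E) := hm'
  have hr : ((z : E) : Tot E) + (r : E) = y₀ := hr
  have hmm : (m' : E) = m := coe_cancel hm' (by rw [add_comm, hz])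
  rw [hmm] at hmt hm'
  have hmw : (m : E) ≤ w := (isGLB_pair_iff.1 hmx).1.1.trans (le_of_add hw)
  have hwr : ((w : E) : Tot E) + (r : E) = (t : E) := by rw [← hy₀, ← hw, ← hr]; abel
  have ho : Orth (m : E) r := Orth.mono ⟨t, hwr⟩ hmw le_rfl
  -- The hypotheses of `IsTame.le_of_ceil_sub` are symmetric in the two remainders `m = y ⊖ z` and
  -- `r = y₀ ⊖ z`.
  have hmr : (m : E) = r := le_antisymm
    (hE.le_of_ceil_sub m.2 r.2 (hE.sd.isHat_iff.1 hmt) ho fun g d hg hd =>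
      hE.exists_ceil_sub hy h₀ hm' hr hg hd)
    (hE.le_of_ceil_sub r.2 m.2 (hE.sd.isHat_iff.1 hrt) ho.symm fun g d hg hd =>
      hE.exists_ceil_sub h₀ hy hr hm' hg hd)
  rw [← hmr] at hr
  rw [hr] at hm'
  rw [← coe_inj.1 hm', hy₀]

end Tame

/-! ### Finite decompositions and the description of blocks -/

section Refinement

variable {E : Type u} [EffectAlgebra E]

/-- The sum of a finite family, in `Tot E`. -/
def tsum (R : Multiset E) : Tot E := (R.map toTot).sum

theorem tsum_nil : tsum (0 : Multiset E) = 0 := rfl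

theorem tsum_cons (a : E) (R : Multiset E) : tsum (a ::ₘ R) = (a : Tot E) + tsum R := by
  rw [tsum, Multiset.map_cons, Multiset.sum_cons, tsum]

theorem tsum_add (R R' : Multiset E) : tsum (R + R') = tsum R + tsum R' := by
  rw [tsum, Multiset.map_add, Multiset.sum_add, tsum, tsum]

theorem tsum_singleton (a : E) : tsum {a} = (a : Tot E) := by
  rw [tsum, Multiset.map_singleton, Multiset.sum_singleton]

/-- Every partial sum of `R` is a partial sum of `R'`, and the total sums agree. -/
def Refines (R' R : Multiset E) : Prop :=
  tsum R' = tsum R ∧ ∀ A ≤ R, ∃ A' ≤ R', tsum A' = tsum A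

/-- `x` is a partial sum of `R`. -/
def Covers (R : Multiset E) (x : E) : Prop := ∃ A ≤ R, tsum A = x

theorem Refines.refl (R : Multiset E) : Refines R R := ⟨rfl, fun A hA => ⟨A, hA, rfl⟩⟩

theorem Refines.trans {R₁ R₂ R₃ : Multiset E} (h : Refines R₁ R₂) (h' : Refines R₂ R₃) :
    Refines R₁ R₃ := by
  refine ⟨h.1.trans h'.1, fun A hA => ?_⟩
  obtain ⟨B, hB, hBA⟩ := h'.2 A hA
  obtain ⟨C, hC, hCB⟩ := h.2 B hB
  exact ⟨C, hC, hCB.trans hBA⟩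

theorem Refines.covers {R' R : Multiset E} (h : Refines R' R) {x : E} (hx : Covers R x) :
    Covers R' x := by
  obtain ⟨A, hA, hAx⟩ := hx
  obtain ⟨B, hB, hBA⟩ := h.2 A hA
  exact ⟨B, hB, hBA.trans hAx⟩

theorem Covers.mono {R' R : Multiset E} (h : R ≤ R') {x : E} (hx : Covers R x) :
    Covers R' x := by
  obtain ⟨A, hA, hAx⟩ := hx
  exact ⟨A, hA.trans h, hAx⟩

theorem exists_multiset_add_of_le_add {α : Type*} {A B C : Multiset α} (h : A ≤ B + C) :
    ∃ A₁ A₂, A₁ ≤ B ∧ A₂ ≤ C ∧ A = A₁ + A₂ := by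
  classical
  refine ⟨A ∩ B, A - A ∩ B, Multiset.inter_le_right, ?_, ?_⟩
  · rw [Multiset.le_iff_count] at h ⊢
    intro a
    have := h a
    rw [Multiset.count_add] at this
    rw [Multiset.count_sub, Multiset.count_inter]
    omega
  · exact (add_tsub_cancel_of_le Multiset.inter_le_left).symm

theorem exists_multiset_overlap {α : Type*} {A B R : Multiset α} (hA : A ≤ R) (hB : B ≤ R) :
    ∃ I A₁ B₁ K, A = I + A₁ ∧ B = I + B₁ ∧ R = I + A₁ + B₁ + K := by
  classical
  obtain ⟨A₁, hA₁⟩ := Multiset.le_iff_exists_add.1 (Multiset.inter_le_left (s := A) (t := B))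
  obtain ⟨B₁, hB₁⟩ := Multiset.le_iff_exists_add.1 (Multiset.inter_le_right (s := A) (t := B))
  obtain ⟨K, hK⟩ := Multiset.le_iff_exists_add.1 (Multiset.union_le hA hB)
  refine ⟨A ∩ B, A₁, B₁, K, hA₁, hB₁, ?_⟩
  rw [hK]
  congr 1
  refine add_right_cancel (b := A ∩ B) ?_
  rw [Multiset.union_add_inter]
  calc A + B = (A ∩ B + A₁) + (A ∩ B + B₁) := by rw [← hA₁, ← hB₁]
    _ = A ∩ B + A₁ + B₁ + A ∩ B := by abel

theorem Refines.add {R₁ R₂ R₁' R₂' : Multiset E} (h₁ : Refines R₁' R₁) (h₂ : Refines R₂' R₂) :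
    Refines (R₁' + R₂') (R₁ + R₂) := by
  refine ⟨by rw [tsum_add, tsum_add, h₁.1, h₂.1], fun A hA => ?_⟩
  obtain ⟨A₁, A₂, hA₁, hA₂, rfl⟩ := exists_multiset_add_of_le_add hA
  obtain ⟨B₁, hB₁, h1⟩ := h₁.2 A₁ hA₁
  obtain ⟨B₂, hB₂, h2⟩ := h₂.2 A₂ hA₂
  exact ⟨B₁ + B₂, add_le_add hB₁ hB₂, by rw [tsum_add, tsum_add, h1, h2]⟩

theorem refines_singleton {R : Multiset E} {c : E} (h : tsum R = c) : Refines R {c} := by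
  refine ⟨h.trans (tsum_singleton c).symm, fun A hA => ?_⟩
  rcases Multiset.le_singleton.1 hA with rfl | rfl
  · exact ⟨0, Multiset.zero_le _, rfl⟩
  · exact ⟨R, le_rfl, h.trans (tsum_singleton c).symm⟩

theorem exists_coe_eq_tsum {A R : Multiset E} (hA : A ≤ R) {z : E} (h : tsum R = z) :
    ∃ x : E, tsum A = x := by
  obtain ⟨B, rfl⟩ := Multiset.le_iff_exists_add.1 hA
  rw [tsum_add] at h
  exact defined_left h

theorem le_of_tsum {A R : Multiset E} (hA : A ≤ R) {x z : E} (hx : tsum A = x)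
    (h : tsum R = z) : x ≤ z := by
  obtain ⟨B, rfl⟩ := Multiset.le_iff_exists_add.1 hA
  rw [tsum_add, hx] at h
  exact le_of_add h

theorem le_of_mem_tsum {R : Multiset E} {x z : E} (hx : x ∈ R) (h : tsum R = z) : x ≤ z :=
  le_of_tsum (Multiset.singleton_le.2 hx) (tsum_singleton x) h

/-- If `v` splits along binary decompositions, it splits along finite ones. -/
theorem exists_refines_of_split {K P : Set E} {S : E → E → Prop}
    (h0 : ∀ v, S v 0 → v = 0)
    (hstep : ∀ v c a b : E, S v c → a ∈ K → (a : Tot E) + b = c →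
      ∃ v₁ v₂ : E, v₁ ∈ P ∧ v₁ ≤ a ∧ S v₂ b ∧ (v₁ : Tot E) + v₂ = v)
    (L : Multiset E) (hL : ∀ a ∈ L, a ∈ K) (v c : E) (hc : tsum L = c) (hS : S v c) :
    ∃ D C : Multiset E, tsum D = v ∧ Refines (D + C) L ∧
      (∀ d ∈ D, d ∈ P ∧ ∃ r ∈ L, ∃ e ∈ C, (d : Tot E) + (e : E) = (r : E)) ∧
      (∀ e ∈ C, ∃ r ∈ L, ∃ d ∈ D, ((d : E) : Tot E) + e = (r : E)) := by
  induction L using Multiset.induction generalizing v c with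
  | empty =>
    have hv : v = 0 := h0 v (by rwa [← coe_inj.1 hc] at hS)
    exact ⟨0, 0, by rw [hv, tsum_nil, coe_zero], Refines.refl 0, fun d hd => absurd hd (Multiset.notMem_zero d),
      fun d hd => absurd hd (Multiset.notMem_zero d)⟩
  | cons a L ih =>
    rw [tsum_cons] at hc
    obtain ⟨b, hb⟩ := defined_right hc
    rw [hb] at hc
    -- `S` is the invariant handed on to the sum of the remaining members; `P` records where the
    -- pieces of `v` lie.
    obtain ⟨v₁, v₂, h1, h2, h3, h4⟩ := hstep v c a b hS (hL a (Multiset.mem_cons_self a L)) hc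
    obtain ⟨D, C, hD, hR, hDs, hCs⟩ :=
      ih (fun x hx => hL x (Multiset.mem_cons_of_mem hx)) v₂ b hb h3
    obtain ⟨e, he⟩ := le_iff.1 h2
    refine ⟨v₁ ::ₘ D, e ::ₘ C, by rw [tsum_cons, hD, h4], ?_, ?_, ?_⟩
    · have h5 : tsum ({v₁, e} : Multiset E) = a := by
        rw [Multiset.insert_eq_cons, tsum_cons, tsum_singleton, he]
      have h6 := (refines_singleton h5).add hR
      have h7 : v₁ ::ₘ D + e ::ₘ C = {v₁, e} + (D + C) := by
        simp only [Multiset.insert_eq_cons, ← Multiset.singleton_add]; abel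
      rwa [h7, ← Multiset.singleton_add a L]
    · intro d hd
      rcases Multiset.mem_cons.1 hd with rfl | hd
      · exact ⟨h1, a, Multiset.mem_cons_self a L, e, Multiset.mem_cons_self e C, he⟩
      · obtain ⟨hdP, r, hr, e', he', hde⟩ := hDs d hd
        exact ⟨hdP, r, Multiset.mem_cons_of_mem hr, e', Multiset.mem_cons_of_mem he', hde⟩
    · intro d hd
      rcases Multiset.mem_cons.1 hd with rfl | hd
      · exact ⟨a, Multiset.mem_cons_self a L, v₁, Multiset.mem_cons_self v₁ D, he⟩
      · obtain ⟨r, hr, e', he', hde⟩ := hCs d hd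
        exact ⟨r, Multiset.mem_cons_of_mem hr, e', Multiset.mem_cons_of_mem he', hde⟩

theorem IsHomogeneous.exists_refines (hH : IsHomogeneous E) {L : Multiset E} {v c : E}
    (hc : tsum L = c) (hv : v ≤ c) (ho : Orth c v) :
    ∃ D C : Multiset E, tsum D = v ∧ Refines (D + C) L ∧
      (∀ d ∈ D, ∃ r ∈ L, ∃ e ∈ C, (d : Tot E) + (e : E) = (r : E)) ∧
      (∀ e ∈ C, ∃ r ∈ L, ∃ d ∈ D, ((d : E) : Tot E) + e = (r : E)) := by
  obtain ⟨D, C, h1, h2, h3, h4⟩ := exists_refines_of_split (K := Set.univ) (P := Set.univ)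
    (S := fun v c => v ≤ c ∧ Orth c v) (fun v h => le_zero h.1) (fun v c a b h _ hab => by
      obtain ⟨v₁, v₂, h1, h2, h3⟩ := hH.split hab h.1 h.2
      exact ⟨v₁, v₂, trivial, h1, ⟨h2, h.2.mono (le_of_add' hab) (le_of_add' h3)⟩, h3⟩)
    L (fun _ _ => trivial) v c hc ⟨hv, ho⟩
  exact ⟨D, C, h1, h2, fun d hd => (h3 d hd).2, h4⟩

theorem exists_refines_of_forall {P : Set E} {D : Multiset E}
    (h : ∀ d ∈ D, ∃ H : Multiset E, (∀ x ∈ H, x ∈ P) ∧ tsum H = d) :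
    ∃ D' : Multiset E, (∀ x ∈ D', x ∈ P) ∧ Refines D' D := by
  induction D using Multiset.induction with
  | empty => exact ⟨0, fun d hd => absurd hd (Multiset.notMem_zero d), Refines.refl 0⟩
  | cons a D ih =>
    obtain ⟨D', h1, h2⟩ := ih fun d hd => h d (Multiset.mem_cons_of_mem hd)
    obtain ⟨H, h3, h4⟩ := h a (Multiset.mem_cons_self a D)
    refine ⟨H + D', fun x hx => ?_, ?_⟩
    · rcases Multiset.mem_add.1 hx with hx | hx
      · exact h3 x hx
      · exact h1 x hx
    · rw [← Multiset.singleton_add]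
      exact (refines_singleton h4).add h2

/-! ### Internally compatible sets -/

/-- `R` is a finite decomposition of the unit in `M` that covers `F`. -/
def IsCover (M F : Set E) (R : Multiset E) : Prop :=
  (∀ r ∈ R, r ∈ M) ∧ tsum R = (1 : E) ∧ ∀ x ∈ F, Covers R x

/-- A set is internally compatible if each finite subset is covered by a finite decomposition of
the unit in the set. -/
def IsIC (M : Set E) : Prop := ∀ F ⊆ M, F.Finite → ∃ R, IsCover M F R

theorem exists_maximal_isIC {M : Set E} (hM : IsIC M) :
    ∃ M', M ⊆ M' ∧ Maximal (fun M : Set E => IsIC M) M' := by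
  refine zorn_subset_nonempty {M : Set E | IsIC M} (fun c hc hch hne => ?_) M hM
  refine ⟨⋃₀ c, fun F hF hfin => ?_, fun s hs => Set.subset_sUnion_of_mem hs⟩
  obtain ⟨N, hN, hFN⟩ :=
    DirectedOn.exists_mem_subset_of_finite_of_subset_sUnion hne hch.directedOn hfin hF
  obtain ⟨R, h1, h2, h3⟩ := hc hN F hFN hfin
  exact ⟨R, fun r hr => ⟨N, hN, h1 r hr⟩, h2, h3⟩

/-- In a cover whose subfamily `L` sums to `u`, only `L` is refined, once for each required element
below `u`. The new members stay below `u`. -/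
theorem IsIC.union_Iic {M : Set E} (hM : IsIC M) {u : E} (hu : u ∈ M)
    (hsplit : ∀ c v a b : E, c ≤ u → v ≤ c → (a : Tot E) + b = c →
      ∃ v₁ v₂ : E, v₁ ≤ a ∧ v₂ ≤ b ∧ (v₁ : Tot E) + v₂ = v) : IsIC (M ∪ Set.Iic u) := by
  have key : ∀ F : Set E, F.Finite → F ⊆ Set.Iic u → ∀ L : Multiset E, tsum L = u →
      ∃ L', Refines L' L ∧ ∀ f ∈ F, Covers L' f := by
    intro F hF
    induction F, hF using Set.Finite.induction_on with
    | empty => exact fun _ L _ => ⟨L, Refines.refl L, fun f hf => absurd hf (Set.notMem_empty f)⟩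
    | @insert f F _ _ ih =>
      intro hsub L hL
      obtain ⟨L', h1, h2⟩ := ih ((Set.subset_insert f F).trans hsub) L hL
      obtain ⟨D, C, h3, h4, -, -⟩ := exists_refines_of_split (K := Set.univ) (P := Set.univ)
        (S := fun v c => v ≤ c ∧ c ≤ u) (fun v h => le_zero h.1) (fun v c a b h _ hab => by
          obtain ⟨v₁, v₂, h1, h2, h3⟩ := hsplit c v a b h.2 h.1 hab
          exact ⟨v₁, v₂, trivial, h1, ⟨h2, (le_of_add' hab).trans h.2⟩, h3⟩)
        L' (fun _ _ => trivial) f u (h1.1.trans hL) ⟨hsub (Set.mem_insert f F), le_rfl⟩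
      refine ⟨D + C, h4.trans h1, fun g hg => ?_⟩
      rcases hg with rfl | hg
      · exact ⟨D, Multiset.le_add_right D C, h3⟩
      · exact h4.covers (h2 g hg)
  intro F hF hfin
  obtain ⟨R, hR⟩ := hM (insert u (F ∩ M)) (Set.insert_subset hu Set.inter_subset_right)
    ((hfin.subset Set.inter_subset_left).insert u)
  obtain ⟨L, hL, hLu⟩ := hR.2.2 u (Set.mem_insert u _)
  obtain ⟨K, rfl⟩ := Multiset.le_iff_exists_add.1 hL
  obtain ⟨L', h1, h2⟩ := key (F ∩ Set.Iic u) (hfin.subset Set.inter_subset_left)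
    Set.inter_subset_right L hLu
  have h3 := h1.add (Refines.refl K)
  refine ⟨L' + K, fun r hr => ?_, h3.1.trans hR.2.1, fun x hx => ?_⟩
  · rcases Multiset.mem_add.1 hr with hr | hr
    · exact Or.inr (le_of_mem_tsum hr (h1.1.trans hLu))
    · exact Or.inl (hR.1 r (Multiset.mem_add.2 (Or.inr hr)))
  · rcases hF hx with hxM | hxu
    · exact h3.covers (hR.2.2 x (Set.mem_insert_of_mem u ⟨hx, hxM⟩))
    · exact (h2 x ⟨hx, hxu⟩).mono (Multiset.le_add_right L' K)

section MaximalIC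

variable {M : Set E}

theorem mem_of_covers (hM : Maximal (fun M : Set E => IsIC M) M) {z : E}
    (h : ∀ F ⊆ M, F.Finite → ∃ R, IsCover M (insert z F) R) : z ∈ M := by
  refine hM.2 (y := insert z M) (fun F hF hfin => ?_) (Set.subset_insert z M)
    (Set.mem_insert z M)
  obtain ⟨R, h1, h2, h3⟩ := h (F ∩ M) Set.inter_subset_right (hfin.subset Set.inter_subset_left)
  refine ⟨R, fun r hr => Set.mem_insert_of_mem z (h1 r hr), h2, fun x hx => h3 x ?_⟩
  rcases hF hx with rfl | hxM
  · exact Set.mem_insert x _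
  · exact Set.mem_insert_of_mem z ⟨hx, hxM⟩

theorem Iic_subset_of_split (hM : Maximal (fun M : Set E => IsIC M) M) {u : E} (hu : u ∈ M)
    (hsplit : ∀ c v a b : E, c ≤ u → v ≤ c → (a : Tot E) + b = c →
      ∃ v₁ v₂ : E, v₁ ≤ a ∧ v₂ ≤ b ∧ (v₁ : Tot E) + v₂ = v) : Set.Iic u ⊆ M :=
  Set.subset_union_right.trans (hM.2 (hM.1.union_Iic hu hsplit) Set.subset_union_left)

theorem Iic_subset_of_orth_self (hM : Maximal (fun M : Set E => IsIC M) M)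
    (hH : IsHomogeneous E) {u : E} (hu : u ∈ M) (ho : Orth u u) : Set.Iic u ⊆ M :=
  Iic_subset_of_split hM hu fun _ _ _ _ hc hv hab =>
    hH.split hab hv (ho.mono hc (hv.trans hc))

/-- The elements obtained from those of `M` by subtracting elements `d ∈ M` with `d ≤ d'`. -/
def subHyper (M : Set E) : Set E :=
  {c | ∃ r ∈ M, ∃ H : Multiset E, (∀ d ∈ H, d ∈ M ∧ Orth d d) ∧ tsum H + c = (r : Tot E)}

theorem subset_subHyper (M : Set E) : M ⊆ subHyper M := fun c hc =>
  ⟨c, hc, 0, fun d hd => absurd hd (Multiset.notMem_zero d), by rw [tsum_nil, zero_add]⟩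

theorem subHyper_sub {c d e : E} (hc : c ∈ subHyper M) (hd : d ∈ M) (ho : Orth d d)
    (h : (d : Tot E) + e = c) : e ∈ subHyper M := by
  obtain ⟨r, hr, H, hH, hHc⟩ := hc
  refine ⟨r, hr, d ::ₘ H, fun x hx => ?_, ?_⟩
  · rcases Multiset.mem_cons.1 hx with rfl | hx
    · exact ⟨hd, ho⟩
    · exact hH x hx
  · rw [← hHc, ← h, tsum_cons]; abel

/-- After cancelling the overlap of the families for `r` and `d`, what is left of `d` is the sum `b`
of a subfamily disjoint from the one for `a`, so it is orthogonal to `a` and splits along it. The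
pieces of `b` are in `M` because `d` is orthogonal to itself; the complementary pieces sum to `e`.
-/
theorem exists_refines_sub (hM : Maximal (fun M : Set E => IsIC M) M) (hH : IsHomogeneous E)
    {R : Multiset E} (hR : ∀ r ∈ R, r ∈ subHyper M) (h1 : tsum R = (1 : E)) {r d e : E}
    (hr : Covers R r) (hdR : Covers R d) (hd : d ∈ M) (ho : Orth d d)
    (h : (d : Tot E) + e = r) :
    ∃ R', (∀ r ∈ R', r ∈ subHyper M) ∧ Refines R' R ∧ Covers R' e := by
  obtain ⟨A, hA, hAr⟩ := hr
  obtain ⟨B, hB, hBd⟩ := hdR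
  obtain ⟨I, A₁, B₁, K, rfl, rfl, rfl⟩ := exists_multiset_overlap hA hB
  simp only [tsum_add] at h1 hAr hBd
  obtain ⟨i, hi⟩ := defined_left hAr
  obtain ⟨a, ha⟩ := defined_right hAr
  obtain ⟨b, hb⟩ := defined_right hBd
  rw [hi, ha] at hAr
  rw [hi, hb] at hBd
  have hbe : (b : Tot E) + e = a := by
    refine tot_cancel (a := i) (z := r) ?_ hAr
    rw [← add_assoc, hBd, h]
  have hab : Orth a b := by
    rw [ha, hb] at h1
    have h2 : ((a : Tot E) + b) + (tsum I + tsum K) = (1 : E) := by rw [← h1]; abel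
    exact defined_left h2
  obtain ⟨D, C, hD, hDC, hDs, hCs⟩ := hH.exists_refines ha (le_of_add hbe) hab
  have hbd : b ≤ d := le_of_add' hBd
  have hdM : ∀ x ∈ D, x ∈ M := fun x hx =>
    Iic_subset_of_orth_self hM hH hd ho ((le_of_mem_tsum hx hD).trans hbd)
  refine ⟨D + C + (I + B₁ + K), fun x hx => ?_, ?_, C, ?_, ?_⟩
  · rcases Multiset.mem_add.1 hx with hx | hx
    · rcases Multiset.mem_add.1 hx with hx | hx
      · exact subset_subHyper M (hdM x hx)
      · obtain ⟨s, hs, f, hf, hfx⟩ := hCs x hx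
        have hfd := (le_of_mem_tsum hf hD).trans hbd
        refine subHyper_sub (hR s ?_) (hdM f hf) (ho.mono hfd hfd) hfx
        simp only [Multiset.mem_add, hs, true_or, or_true]
    · refine hR x ?_
      simp only [Multiset.mem_add] at hx ⊢
      tauto
  · have h3 := hDC.add (Refines.refl (I + B₁ + K))
    rwa [show A₁ + (I + B₁ + K) = I + A₁ + B₁ + K by abel] at h3
  · exact (Multiset.le_add_left C D).trans (Multiset.le_add_right _ _)
  · refine tot_cancel (a := b) (z := a) ?_ hbe
    rw [← hD, ← tsum_add, hDC.1, ha]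

theorem exists_refines_sub_multiset (hM : Maximal (fun M : Set E => IsIC M) M)
    (hH : IsHomogeneous E) (H : Multiset E) (hHM : ∀ d ∈ H, d ∈ M ∧ Orth d d) (e : E)
    {R : Multiset E} (hR : ∀ r ∈ R, r ∈ subHyper M) (h1 : tsum R = (1 : E)) {r : E}
    (hr : Covers R r) (hcov : ∀ d ∈ H, Covers R d) (h : tsum H + e = (r : Tot E)) :
    ∃ R', (∀ r ∈ R', r ∈ subHyper M) ∧ Refines R' R ∧ Covers R' e := by
  induction H using Multiset.induction generalizing R r with
  | empty =>
    rw [tsum_nil, zero_add] at h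
    rw [coe_inj.1 h]
    exact ⟨R, hR, Refines.refl R, hr⟩
  | cons d H ih =>
    rw [tsum_cons, add_assoc] at h
    obtain ⟨r', hr'⟩ := defined_right h
    rw [hr'] at h
    have hd := hHM d (Multiset.mem_cons_self d H)
    obtain ⟨R₁, h2, h3, h4⟩ := exists_refines_sub hM hH hR h1 hr
      (hcov d (Multiset.mem_cons_self d H)) hd.1 hd.2 h
    obtain ⟨R₂, h5, h6, h7⟩ := ih (fun x hx => hHM x (Multiset.mem_cons_of_mem hx)) h2
      (h3.1.trans h1) h4 (fun x hx => h3.covers (hcov x (Multiset.mem_cons_of_mem hx))) hr'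
    exact ⟨R₂, h5, h6.trans h3, h7⟩

theorem isIC_subHyper (hM : Maximal (fun M : Set E => IsIC M) M) (hH : IsHomogeneous E) :
    IsIC (subHyper M) := by
  have key : ∀ F : Set E, F.Finite → F ⊆ subHyper M → ∀ G ⊆ M, G.Finite →
      ∃ R, IsCover (subHyper M) (F ∪ G) R := by
    intro F hF
    induction F, hF using Set.Finite.induction_on with
    | empty =>
      intro _ G hG hfin
      obtain ⟨R, h1, h2, h3⟩ := hM.1 G hG hfin
      exact ⟨R, fun r hr => subset_subHyper M (h1 r hr), h2, by rwa [Set.empty_union]⟩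
    | @insert f F _ _ ih =>
      intro hsub G hG hfin
      obtain ⟨r, hr, H, hHM, hHf⟩ := hsub (Set.mem_insert f F)
      obtain ⟨R, hR⟩ := ih ((Set.subset_insert f F).trans hsub) (insert r (G ∪ {d | d ∈ H}))
        (Set.insert_subset hr (Set.union_subset hG fun d hd => (hHM d hd).1))
        ((hfin.union H.finite_toSet).insert r)
      obtain ⟨R', h1, h2, h3⟩ := exists_refines_sub_multiset hM hH H hHM f hR.1 hR.2.1
        (hR.2.2 r (Or.inr (Set.mem_insert r _)))
        (fun d hd => hR.2.2 d (Or.inr (Or.inr (Or.inr hd)))) hHf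
      refine ⟨R', h1, h2.1.trans hR.2.1, fun x hx => ?_⟩
      rcases hx with (rfl | hx) | hx
      · exact h3
      · exact h2.covers (hR.2.2 x (Or.inl hx))
      · exact h2.covers (hR.2.2 x (Or.inr (Or.inr (Or.inl hx))))
  intro F hF hfin
  obtain ⟨R, hR⟩ := key F hfin hF ∅ (Set.empty_subset M) Set.finite_empty
  rw [Set.union_empty] at hR
  exact ⟨R, hR⟩

/-- By maximality `subHyper M` is contained in `M`. -/
theorem mem_of_sub (hM : Maximal (fun M : Set E => IsIC M) M) (hH : IsHomogeneous E)
    {H : Multiset E} (hHM : ∀ d ∈ H, d ∈ M ∧ Orth d d) {r c : E} (hr : r ∈ M)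
    (h : tsum H + c = (r : Tot E)) : c ∈ M :=
  hM.2 (isIC_subHyper hM hH) (subset_subHyper M) ⟨r, hr, H, hHM, h⟩

/-- Covers can be refined so that two given orthogonal elements become sums of disjoint
subfamilies. -/
theorem exists_refines_orth (hM : Maximal (fun M : Set E => IsIC M) M) (hH : IsHomogeneous E)
    {R : Multiset E} (hR : ∀ r ∈ R, r ∈ M) (h1 : tsum R = (1 : E)) {x y : E} (hx : Covers R x)
    (hy : Covers R y) (ho : Orth x y) :
    ∃ R', (∀ r ∈ R', r ∈ M) ∧ Refines R' R ∧
      ∃ A B, A + B ≤ R' ∧ tsum A = x ∧ tsum B = y := by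
  obtain ⟨A, hA, hAx⟩ := hx
  obtain ⟨B, hB, hBy⟩ := hy
  obtain ⟨I, A₁, B₁, K, rfl, rfl, rfl⟩ := exists_multiset_overlap hA hB
  obtain ⟨z, hz⟩ := ho
  rw [← hAx, ← hBy, tsum_add, tsum_add] at hz
  have hz' : tsum I + (tsum I + tsum A₁ + tsum B₁) = (z : Tot E) := by rw [← hz]; abel
  obtain ⟨ω, hω⟩ := defined_left hz'
  obtain ⟨s, hs⟩ := defined_right hz'
  rw [tsum_add] at h1
  obtain ⟨κ, hκ⟩ := defined_right h1
  have h1' : (s : Tot E) + κ = (1 : E) := by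
    rw [← hs, ← h1, ← hκ, tsum_add, tsum_add]
  have hωs : ω ≤ s := by
    rw [add_assoc, hω] at hs
    exact le_of_add hs
  -- Orthogonality of `x` and `y` makes the overlap sum `ω` available twice, so a second copy of it
  -- fits into the complementary family `K`.
  have hωκ : ω ≤ κ := by
    rw [eq_compl_of_add h1', le_compl_iff]
    rw [hω, ← hω, hs, hω] at hz'
    exact ⟨z, hz'⟩
  have hκω : Orth κ ω := Orth.mono ⟨1, by rw [add_comm, h1']⟩ le_rfl hωs
  obtain ⟨D, C, hD, hDC, hDs, hCs⟩ := hH.exists_refines hκ hωκ hκω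
  -- A piece `d ≤ ω` of that copy need not lie in `M`, but it splits further along `I`, whose
  -- members are in `M` and self-orthogonal.
  have hpieces : ∀ d ∈ D, ∃ H : Multiset E, (∀ x ∈ H, x ∈ {x | x ∈ M ∧ Orth x x}) ∧
      tsum H = d := by
    intro d hd
    have hdω : d ≤ ω := le_of_mem_tsum hd hD
    obtain ⟨H, H', h2, -, h3, -⟩ := hH.exists_refines hω hdω (hκω.mono hωκ hdω)
    refine ⟨H, fun x hx => ?_, h2⟩
    obtain ⟨o, hoI, e, -, hoe⟩ := h3 x hx
    have hoω : o ≤ ω := le_of_mem_tsum hoI hω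
    have hoM : o ∈ M := hR o (by simp only [Multiset.mem_add, hoI, true_or])
    have hoo : Orth o o := hκω.mono (hoω.trans hωκ) hoω
    exact ⟨Iic_subset_of_orth_self hM hH hoM hoo (le_of_add hoe),
      hoo.mono (le_of_add hoe) (le_of_add hoe)⟩
  obtain ⟨D', hD', hDD'⟩ := exists_refines_of_forall hpieces
  have h2 : Refines (D' + C) K := (hDD'.add (Refines.refl C)).trans hDC
  -- In the family for `y` the overlap `I` is exchanged for its copy `D'` taken from `K`.
  refine ⟨I + A₁ + B₁ + (D' + C), fun r hr => ?_, (Refines.refl _).add h2, I + A₁, B₁ + D', ?_,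
    hAx, ?_⟩
  · rcases Multiset.mem_add.1 hr with hr | hr
    · exact hR r (Multiset.mem_add.2 (Or.inl hr))
    · rcases Multiset.mem_add.1 hr with hr | hr
      · exact (hD' r hr).1
      · obtain ⟨k, hk, d, hd, hdr⟩ := hCs r hr
        obtain ⟨H, hHM, hHd⟩ := hpieces d hd
        exact mem_of_sub hM hH hHM (hR k (Multiset.mem_add.2 (Or.inr hk))) (hHd ▸ hdr)
  · rw [show I + A₁ + (B₁ + D') = I + A₁ + B₁ + D' by abel, ← add_assoc]
    exact Multiset.le_add_right _ _
  · rw [tsum_add, hDD'.1, hD, ← hω, add_comm, ← tsum_add, hBy]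

theorem add_mem_of_maximal (hM : Maximal (fun M : Set E => IsIC M) M) (hH : IsHomogeneous E)
    {x y z : E} (hx : x ∈ M) (hy : y ∈ M) (h : (x : Tot E) + y = z) : z ∈ M := by
  refine mem_of_covers hM fun F hF hfin => ?_
  obtain ⟨R, hR⟩ := hM.1 (insert x (insert y F)) (Set.insert_subset hx (Set.insert_subset hy hF))
    ((hfin.insert y).insert x)
  obtain ⟨R', h1, h2, A, B, h3, hA, hB⟩ := exists_refines_orth hM hH hR.1 hR.2.1
    (hR.2.2 x (Or.inl rfl)) (hR.2.2 y (Or.inr (Or.inl rfl))) ⟨z, h⟩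
  refine ⟨R', h1, h2.1.trans hR.2.1, fun f hf => ?_⟩
  rcases hf with rfl | hf
  · exact ⟨A + B, h3, by rw [tsum_add, hA, hB, h]⟩
  · exact h2.covers (hR.2.2 f (Or.inr (Or.inr hf)))

theorem compl_mem_of_maximal (hM : Maximal (fun M : Set E => IsIC M) M) {x : E} (hx : x ∈ M) :
    compl x ∈ M := by
  refine mem_of_covers hM fun F hF hfin => ?_
  obtain ⟨R, hR⟩ := hM.1 (insert x F) (Set.insert_subset hx hF) (hfin.insert x)
  refine ⟨R, hR.1, hR.2.1, fun f hf => ?_⟩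
  rcases hf with rfl | hf
  · obtain ⟨A, hA, hAx⟩ := hR.2.2 x (Or.inl rfl)
    obtain ⟨B, rfl⟩ := Multiset.le_iff_exists_add.1 hA
    refine ⟨B, Multiset.le_add_left B A, tot_cancel (a := x) (z := 1) ?_ (coe_add_compl x)⟩
    rw [← hAx, ← tsum_add, hR.2.1]
  · exact hR.2.2 f (Or.inr hf)

theorem isSubEA_of_maximal (hM : Maximal (fun M : Set E => IsIC M) M) (hH : IsHomogeneous E) :
    IsSubEA M := by
  have hsub : ∀ x y z : E, (x : Tot E) + y = z → x ∈ M → z ∈ M → y ∈ M := by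
    intro x y z h hx hz
    have h1 : ((compl z : E) : Tot E) + x + y = (1 : E) := by
      rw [← coe_add_compl z, ← h]; abel
    obtain ⟨w, hw⟩ := defined_left h1
    rw [hw] at h1
    rw [eq_compl_of_add h1]
    exact compl_mem_of_maximal hM (add_mem_of_maximal hM hH (compl_mem_of_maximal hM hz) hx hw)
  refine ⟨mem_of_covers hM fun F hF hfin => ?_, fun x y z h hxyz => ?_⟩
  · obtain ⟨R, hR⟩ := hM.1 F hF hfin
    refine ⟨R, hR.1, hR.2.1, fun f hf => ?_⟩
    rcases hf with rfl | hf
    · exact ⟨R, le_rfl, hR.2.1⟩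
    · exact hR.2.2 f hf
  · have h : (x : Tot E) + y = z := h
    rcases hxyz with ⟨hx, hy⟩ | ⟨hx, hz⟩ | ⟨hy, hz⟩
    · exact ⟨hx, hy, add_mem_of_maximal hM hH hx hy h⟩
    · exact ⟨hx, hsub x y z h hx hz, hz⟩
    · exact ⟨hsub y x z (by rw [add_comm, h]) hy hz, hy, hz⟩

end MaximalIC

section SubEA

variable {Q : Set E}

theorem IsSubEA.add_mem (hQ : IsSubEA Q) {x y z : E} (hx : x ∈ Q) (hy : y ∈ Q)
    (h : (x : Tot E) + y = z) : z ∈ Q := (hQ.2 x y z h (Or.inl ⟨hx, hy⟩)).2.2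

theorem IsSubEA.sub_mem (hQ : IsSubEA Q) {x y z : E} (hx : x ∈ Q) (hz : z ∈ Q)
    (h : (x : Tot E) + y = z) : y ∈ Q := (hQ.2 x y z h (Or.inr (Or.inl ⟨hx, hz⟩))).2.1

theorem IsSubEA.compl_mem (hQ : IsSubEA Q) {x : E} (hx : x ∈ Q) : compl x ∈ Q :=
  hQ.sub_mem hx hQ.1 (coe_add_compl x)

theorem IsSubEA.zero_mem (hQ : IsSubEA Q) : (0 : E) ∈ Q := by
  rw [← compl_one]; exact hQ.compl_mem hQ.1

theorem IsSubEA.tsum_mem (hQ : IsSubEA Q) {R : Multiset E} (hR : ∀ r ∈ R, r ∈ Q) {z : E}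
    (h : tsum R = z) : z ∈ Q := by
  induction R using Multiset.induction generalizing z with
  | empty => rw [← coe_inj.1 h]; exact hQ.zero_mem
  | cons a R ih =>
    rw [tsum_cons] at h
    obtain ⟨b, hb⟩ := defined_right h
    rw [hb] at h
    exact hQ.add_mem (hR a (Multiset.mem_cons_self a R))
      (ih (fun r hr => hR r (Multiset.mem_cons_of_mem hr)) hb) h

theorem exists_cover_of_hasRDP (hQ : IsSubEA Q) (hR : HasRDP Q) {x : E} (hx : x ∈ Q)
    {F : Set E} (hF : F ⊆ Q) (hFx : F ⊆ Set.Iic x) (hfin : F.Finite) :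
    ∃ L : Multiset E, (∀ l ∈ L, l ∈ Q) ∧ tsum L = x ∧ ∀ f ∈ F, Covers L f := by
  induction F, hfin using Set.Finite.induction_on with
  | empty =>
    exact ⟨{x}, fun l hl => by rwa [Multiset.mem_singleton.1 hl], tsum_singleton x,
      fun f hf => absurd hf (Set.notMem_empty f)⟩
  | @insert f F _ _ ih =>
    obtain ⟨L, h1, h2, h3⟩ := ih ((Set.subset_insert f F).trans hF)
      ((Set.subset_insert f F).trans hFx)
    obtain ⟨D, C, h4, h5, h6, h7⟩ := exists_refines_of_split (K := Q) (P := Q)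
      (S := fun v c => v ≤ c ∧ v ∈ Q ∧ c ∈ Q) (fun v h => le_zero h.1)
      (fun v c a b h ha hab => by
        have hb := hQ.sub_mem ha h.2.2 hab
        obtain ⟨v₁, hv₁, v₂, hv₂, h1, h2, h3⟩ := hR v h.2.1 a ha b hb c h.2.2 hab h.1
        exact ⟨v₁, v₂, hv₁, h1, ⟨h2, hv₂, hb⟩, h3⟩)
      L h1 f x h2 ⟨hFx (Set.mem_insert f F), hF (Set.mem_insert f F), hx⟩
    refine ⟨D + C, fun l hl => ?_, h5.1.trans h2, fun g hg => ?_⟩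
    · rcases Multiset.mem_add.1 hl with hl | hl
      · exact (h6 l hl).1
      · obtain ⟨r, hr, d, hd, hdl⟩ := h7 l hl
        exact hQ.sub_mem (h6 d hd).1 (h1 r hr) hdl
    · rcases hg with rfl | hg
      · exact ⟨D, Multiset.le_add_right D C, h4⟩
      · exact h5.covers (h3 g hg)

theorem isIC_of_hasRDP (hQ : IsSubEA Q) (hR : HasRDP Q) : IsIC Q := fun _ hF hfin =>
  exists_cover_of_hasRDP hQ hR hQ.1 hF (fun f _ => le_one f) hfin

end SubEA

/-- Take disjoint subfamilies for `v₁` and `v₂`. The overlap with the family for `u` is already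
divided between them. -/
theorem hasRDP_of_maximal {M : Set E} (hM : Maximal (fun M : Set E => IsIC M) M)
    (hH : IsHomogeneous E) : HasRDP M := by
  have hS := isSubEA_of_maximal hM hH
  intro u hu v₁ hv₁ v₂ hv₂ w _ hw huw
  obtain ⟨R₀, hR₀⟩ := hM.1 {u, v₁, v₂}
    (Set.insert_subset hu (Set.insert_subset hv₁ (Set.singleton_subset_iff.2 hv₂)))
    (Set.toFinite _)
  obtain ⟨R, hR, href, A, B, hAB, hA, hB⟩ := exists_refines_orth hM hH hR₀.1 hR₀.2.1
    (hR₀.2.2 v₁ (by simp)) (hR₀.2.2 v₂ (by simp)) ⟨w, hw⟩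
  obtain ⟨U, hU, hUu⟩ := href.covers (hR₀.2.2 u (by simp))
  have h1 : tsum R = (1 : E) := href.1.trans hR₀.2.1
  obtain ⟨I, U₁, D, K, rfl, hD, rfl⟩ := exists_multiset_overlap hU hAB
  obtain ⟨I₁, I₂, hI₁, hI₂, rfl⟩ := exists_multiset_add_of_le_add
    ((Multiset.le_add_right I D).trans hD.ge)
  obtain ⟨A', rfl⟩ := Multiset.le_iff_exists_add.1 hI₁
  obtain ⟨B', rfl⟩ := Multiset.le_iff_exists_add.1 hI₂
  have hD' : D = A' + B' := by
    refine add_left_cancel (a := I₁ + I₂) ?_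
    rw [← hD]; abel
  subst hD'
  simp only [tsum_add] at h1 hA hB hUu
  have hwI : (tsum I₁ + tsum I₂) + (tsum A' + tsum B') = (w : Tot E) := by
    rw [← show (v₁ : Tot E) + v₂ = w from hw, ← hA, ← hB]; abel
  obtain ⟨i, hi⟩ := defined_left hwI
  obtain ⟨i₁, hi₁⟩ := defined_left hi
  obtain ⟨i₂, hi₂⟩ := defined_right hi
  obtain ⟨δ, hδ⟩ := defined_right hwI
  obtain ⟨a, ha⟩ := defined_left hδ
  obtain ⟨b, hb⟩ := defined_right hδ
  obtain ⟨α, hα⟩ := defined_right hUu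
  rw [hi, hα] at hUu
  rw [hi, hδ] at hwI
  rw [hi₁, ha] at hA
  rw [hi₂, hb] at hB
  rw [hi, hα, hδ] at h1
  -- The rest `α` of `u` comes from a family disjoint from that of `δ`, so homogeneity splits it
  -- along `δ = a ⊕ b`. It is also self-orthogonal, which puts its pieces into `M`.
  have hαδ : α ≤ δ := le_of_add_le_add hUu hwI huw
  have ho : Orth δ α := by
    have h2 : (δ : Tot E) + α + (i + tsum K) = (1 : E) := by rw [← h1]; abel
    exact defined_left h2
  obtain ⟨α₁, α₂, h3, h4, h5⟩ := hH.split (by rw [ha, hb] at hδ; exact hδ) hαδ ho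
  have hαM : α ∈ M := hS.tsum_mem (fun r hr => hR r (by simp [hr])) hα
  have hαo : Orth α α := ho.mono hαδ le_rfl
  have hu12 : ((i₁ : Tot E) + α₁) + (i₂ + α₂) = u := by
    rw [← hUu, ← hi, hi₁, hi₂, ← h5]; abel
  obtain ⟨u₁, hu₁⟩ := defined_left hu12
  obtain ⟨u₂, hu₂⟩ := defined_right hu12
  rw [hu₁, hu₂] at hu12
  have hle := Iic_subset_of_orth_self hM hH hαM hαo
  refine ⟨u₁, hS.add_mem (hS.tsum_mem (fun r hr => hR r (by simp [hr])) hi₁)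
    (hle (le_of_add h5)) hu₁, u₂, hS.add_mem (hS.tsum_mem (fun r hr => hR r (by simp [hr])) hi₂)
    (hle (le_of_add' h5)) hu₂, sum_le_sum le_rfl h3 hu₁ hA, sum_le_sum le_rfl h4 hu₂ hB, hu12⟩

/-- In a homogeneous effect algebra the blocks are the maximal internally compatible sets. -/
theorem IsHomogeneous.isBlock_iff (hH : IsHomogeneous E) {B : Set E} :
    IsBlock B ↔ Maximal (fun M : Set E => IsIC M) B := by
  constructor
  · intro hB
    obtain ⟨M, hBM, hM⟩ := exists_maximal_isIC (isIC_of_hasRDP hB.1.1 hB.1.2)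
    have := hB.2 ⟨isSubEA_of_maximal hM hH, hasRDP_of_maximal hM hH⟩ hBM
    rwa [Set.Subset.antisymm hBM this]
  · intro hB
    exact ⟨⟨isSubEA_of_maximal hB hH, hasRDP_of_maximal hB hH⟩, fun Q hQ hBQ =>
      hB.2 (isIC_of_hasRDP hQ.1 hQ.2) hBQ⟩

/-- The elements `x`, `y`, `z'` already form a decomposition of the unit. -/
theorem IsHomogeneous.exists_isBlock (hH : IsHomogeneous E) {x y z : E}
    (h : (x : Tot E) + y = z) : ∃ B, IsBlock B ∧ x ∈ B ∧ y ∈ B := by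
  have hIC : IsIC ({x, y, compl z} : Set E) := by
    refine fun F hF _ => ⟨{x, y, compl z}, fun r hr => by simpa using hr, ?_, fun f hf => ?_⟩
    · simp only [Multiset.insert_eq_cons, tsum_cons, tsum_singleton]
      rw [← add_assoc, h, coe_add_compl]
    · have hf' : f ∈ ({x, y, compl z} : Multiset E) := by simpa using hF hf
      exact ⟨{f}, Multiset.singleton_le.2 hf', tsum_singleton f⟩
  obtain ⟨M, h1, h2⟩ := exists_maximal_isIC hIC
  exact ⟨M, hH.isBlock_iff.2 h2, h1 (by simp), h1 (by simp)⟩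

end Refinement

/-! ### Blocks of tame effect algebras contain the intervals `[x̃, x]` -/

section TameBlocks

variable {E : Type u} [EffectAlgebra E]

theorem IsTame.floor_mem_of_maximal (hE : IsTame E) {B : Set E}
    (hB : Maximal (fun M : Set E => IsIC M) B) {x t : E} (hx : x ∈ B) (ht : IsFloor x t) :
    t ∈ B := by
  have hQ := isSubEA_of_maximal hB hE.hom
  have hR := hasRDP_of_maximal hB hE.hom
  obtain ⟨m, hm⟩ := le_iff.1 ht.2.1
  have hmM : m ∈ Mea E := hE.hom.mea_of_isFloor ht hm
  -- `N` consists of the pieces into which elements of `B` below `x` are cut by `x = t ⊕ m`.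
  -- Compatibility of `B ∪ N` puts `t` into `B` by maximality.
  set N : Set E := {z | ∃ c ∈ B, c ≤ x ∧ ∃ a a' : E, (a : Tot E) + a' = c ∧ a ≤ t ∧ a' ≤ m ∧
    (z = a ∨ z = a')} with hN
  -- To cover `f` it suffices to cover suitable elements `c ≤ x` and `d ≤ x'` of `B`. For `f ∈ B`
  -- they come from the Riesz property; for `f ∈ N`, `IsTame.sharp_part_unique` says that a cover of
  -- `c` compatible with `t ⊕ m` cuts it in the prescribed way.
  have hgood : ∀ f ∈ B ∪ N, ∃ c d : E, c ∈ B ∧ c ≤ x ∧ d ∈ B ∧ d ≤ compl x ∧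
      ∀ D C L : Multiset E, tsum D = t → tsum C = m → Covers (D + C) c → Covers L d →
        Covers (D + C + L) f := by
    rintro f (hf | ⟨c, hc, hcx, a, a', haa, hat, ham, hfa⟩)
    · obtain ⟨c, hc, d, hd, hcx, hdx, hcd⟩ := hR f hf x hx (compl x) (hQ.compl_mem hx) 1 hQ.1
        (coe_add_compl x) (le_one f)
      refine ⟨c, d, hc, hcx, hd, hdx, fun D C L _ _ ⟨A, hA, hAc⟩ ⟨A', hA', hAd⟩ => ?_⟩
      refine ⟨A + A', add_le_add hA hA', ?_⟩
      rw [tsum_add, hAc, hAd]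
      exact hcd
    · refine ⟨c, 0, hc, hcx, hQ.zero_mem, zero_le _, fun D C L hD hC ⟨A, hA, hAc⟩ _ => ?_⟩
      obtain ⟨A₁, A₂, hA₁, hA₂, rfl⟩ := exists_multiset_add_of_le_add hA
      obtain ⟨b, hb⟩ := exists_coe_eq_tsum hA₁ hD
      obtain ⟨b', hb'⟩ := exists_coe_eq_tsum hA₂ hC
      rw [tsum_add, hb, hb'] at hAc
      have hab : a = b := hE.sharp_part_unique ht.1 hmM ⟨x, hm⟩ hat ham (le_of_tsum hA₁ hb hD)
        (le_of_tsum hA₂ hb' hC) haa hAc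
      subst hab
      have hab' : a' = b' := coe_cancel haa hAc
      subst hab'
      rcases hfa with rfl | rfl
      · exact ⟨A₁, (hA₁.trans (Multiset.le_add_right D C)).trans (Multiset.le_add_right _ L), hb⟩
      · exact ⟨A₂, (hA₂.trans (Multiset.le_add_left C D)).trans (Multiset.le_add_right _ L), hb'⟩
  have hIC : IsIC (B ∪ N) := by
    intro F hF hfin
    choose! c d hcB hcx hdB hdx hcov using hgood
    obtain ⟨L, hL, hLx, hLc⟩ := exists_cover_of_hasRDP hQ hR hx (F := c '' F)
      (Set.image_subset_iff.2 fun f hf => hcB f (hF hf))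
      (Set.image_subset_iff.2 fun f hf => hcx f (hF hf)) (hfin.image c)
    obtain ⟨L', hL', hLx', hLd⟩ := exists_cover_of_hasRDP hQ hR (hQ.compl_mem hx) (F := d '' F)
      (Set.image_subset_iff.2 fun f hf => hdB f (hF hf))
      (Set.image_subset_iff.2 fun f hf => hdx f (hF hf)) (hfin.image d)
    -- The invariant says that `v` lies between the sharp kernel of `c` and `c`; it survives thanks
    -- to the last clause of `IsTame.split_of_floor_le`.
    obtain ⟨D, C, h1, h2, h3, h4⟩ := exists_refines_of_split (K := Set.univ) (P := Set.univ)
      (S := fun v c => v ≤ c ∧ ∀ s ∈ Sh E, s ≤ c → s ≤ v) (fun v h => le_zero h.1)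
      (fun v c a b h _ hab => by
        obtain ⟨s, hs⟩ := hE.sd.exists_isFloor c
        obtain ⟨v₁, v₂, h1, h2, h3, h4⟩ :=
          hE.split_of_floor_le hs (h.2 s hs.1 hs.2.1) h.1 hab
        exact ⟨v₁, v₂, trivial, h1, ⟨h2, h4⟩, h3⟩)
      L (fun _ _ => trivial) t x hLx ⟨ht.2.1, ht.2.2⟩
    have hC : tsum C = m := by
      refine tot_cancel (a := t) (z := x) ?_ hm
      rw [← h1, ← tsum_add, h2.1, hLx]
    refine ⟨D + C + L', fun r hr => ?_, ?_, fun f hf => ?_⟩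
    · rcases Multiset.mem_add.1 hr with hr | hr
      · rcases Multiset.mem_add.1 hr with hr | hr
        · obtain ⟨-, l, hl, e, he, hre⟩ := h3 r hr
          exact Or.inr ⟨l, hL l hl, le_of_mem_tsum hl hLx, r, e, hre, le_of_mem_tsum hr h1,
            le_of_mem_tsum he hC, Or.inl rfl⟩
        · obtain ⟨l, hl, e, he, hre⟩ := h4 r hr
          exact Or.inr ⟨l, hL l hl, le_of_mem_tsum hl hLx, e, r, hre, le_of_mem_tsum he h1,
            le_of_mem_tsum hr hC, Or.inr rfl⟩
      · exact Or.inl (hL' r hr)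
    · rw [tsum_add, h2.1, hLx, hLx', coe_add_compl]
    · exact hcov f (hF hf) D C L' h1 hC (h2.covers (hLc _ (Set.mem_image_of_mem c hf)))
        (hLd _ (Set.mem_image_of_mem d hf))
  exact hB.2 hIC Set.subset_union_left
    (Or.inr ⟨x, hx, le_rfl, t, m, hm, le_rfl, le_rfl, Or.inl rfl⟩)

theorem IsTame.Icc_floor_subset (hE : IsTame E) {B : Set E} (hB : IsBlock B) {x t : E}
    (hx : x ∈ B) (ht : IsFloor x t) : Set.Icc t x ⊆ B := by
  have hB' := hE.hom.isBlock_iff.1 hB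
  have hQ := hB.1.1
  have htB := hE.floor_mem_of_maximal hB' hx ht
  rintro v ⟨htv, hvx⟩
  obtain ⟨m, hm⟩ := le_iff.1 ht.2.1
  obtain ⟨n, hn, hnm⟩ := exists_add_of_le_of_le hm htv hvx
  have hmM : m ∈ Mea E := hE.hom.mea_of_isFloor ht hm
  exact hQ.add_mem htB (Iic_subset_of_split hB' (hQ.sub_mem htB hx hm)
    (fun c v a b hc hv hab => hE.split_of_mea (mea_of_le hmM hc) hv hab) hnm) hn

theorem IsTame.isTRT (hE : IsTame E) : IsTRT E where
  homogeneous := hE.hom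
  sharplyDominating := hE.sd
  interval_subset B hB x hx t ht := hE.Icc_floor_subset hB hx (hE.sd.isTilde_iff.1 ht)
  unique_residual x t ht y := by
    have ht' := hE.sd.isHat_iff.1 ht
    constructor
    · intro hy
      exact ⟨hE.hom.mea_of_isCeil ht' hy, hE.trtCondition_of_add hy⟩
    · rintro ⟨hy, hc⟩
      exact hE.add_of_trtCondition ht' hc

end TameBlocks

/-! ### Sums of lists and pieces of bounded elements -/

section ListSums

variable {E : Type u} [EffectAlgebra E]

theorem listSum_eq_tsum (l : List E) : (listSum l : Tot E) = tsum (l : Multiset E) := by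
  have key : ∀ (l : List E) (a : E),
      (l.foldlM (fun a x => oplus a x) a : Option E) = (a : Tot E) + tsum (l : Multiset E) := by
    intro l
    induction l with
    | nil => exact fun a => (add_zero (a : Tot E)).symm
    | cons x l ih =>
      intro a
      rw [List.foldlM_cons, ← Multiset.cons_coe, tsum_cons, ← add_assoc]
      change Option.bind (oplus a x) _ = _
      cases hax : oplus a x with
      | none =>
        have : (a : Tot E) + x = (none : Option E) := hax
        rw [this]
        rfl
      | some b =>
        have : (a : Tot E) + x = b := hax
        rw [this]
        exact ih b
  exact (key l 0).trans (by rw [coe_zero, zero_add])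

theorem IsHomogeneous.exists_piece (hH : IsHomogeneous E) {L : Multiset E} {c w : E}
    (hL : tsum L = w) (hc : c ≤ w) (ho : Orth w c) (h0 : c ≠ 0) :
    ∃ d, d ≠ 0 ∧ d ≤ c ∧ ∃ r ∈ L, d ≤ r := by
  obtain ⟨D, C, hD, -, hDL, -⟩ := hH.exists_refines hL hc ho
  by_contra hcon
  push Not at hcon
  have hz : ∀ d ∈ D, d = 0 := by
    intro d hd
    by_contra hd0
    obtain ⟨r, hr, e, -, hde⟩ := hDL d hd
    exact hcon d hd0 (le_of_mem_tsum hd hD) r hr (le_of_add hde)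
  rw [Multiset.eq_replicate_card.2 hz, tsum, Multiset.map_replicate, Multiset.sum_replicate,
    coe_zero, nsmul_zero] at hD
  exact h0 (coe_inj.1 hD).symm

end ListSums

/-! ### Archimedean atomic lattice effect algebras are tame -/

section Lattice

variable {E : Type u} [EffectAlgebra E]

theorem IsLatticeEA.exists_inf (hL : IsLatticeEA E) (x y : E) : ∃ m p q : E,
    (m : Tot E) + p = x ∧ (m : Tot E) + q = y ∧ Disj p q ∧ ∀ c, c ≤ x → c ≤ y → c ≤ m := by
  obtain ⟨m, hm⟩ := (hL x y).1
  obtain ⟨⟨hmx, hmy⟩, hm⟩ := isGLB_pair_iff.1 hm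
  obtain ⟨p, hp⟩ := le_iff.1 hmx
  obtain ⟨q, hq⟩ := le_iff.1 hmy
  refine ⟨m, p, q, hp, hq, fun c hcp hcq => ?_, hm⟩
  obtain ⟨e, he⟩ : Orth m c := Orth.mono ⟨x, hp⟩ le_rfl hcp
  have h1 : e = m := le_antisymm
    (hm e (sum_le_sum le_rfl hcp he hp) (sum_le_sum le_rfl hcq he hq)) (le_of_add he)
  rw [h1] at he
  exact eq_zero_of_add_eq_self he

theorem IsLatticeEA.exists_sup (hL : IsLatticeEA E) (x y : E) :
    ∃ j, x ≤ j ∧ y ≤ j ∧ ∀ c, x ≤ c → y ≤ c → j ≤ c := by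
  obtain ⟨j, hj⟩ := (hL x y).2
  refine ⟨j, hj.1 (by simp), hj.1 (by simp), fun c hx hy => hj.2 ?_⟩
  rintro z (rfl | rfl) <;> assumption

/-- Remove `u ∧ v₁` from `u` and `v₁`. The remainders `p`, `q` are disjoint and orthogonal, so `q ⊕
p` is their join and lies below `q ⊕ v₂`; thus `p ≤ v₂`. -/
theorem IsLatticeEA.isHomogeneous (hL : IsLatticeEA E) : IsHomogeneous E := by
  intro u v₁ v₂ w hw huw hwu
  have hw : (v₁ : Tot E) + v₂ = w := hw
  obtain ⟨m, p, q, hp, hq, hd, -⟩ := hL.exists_inf u v₁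
  have h1 : (m : Tot E) + (q + v₂) = w := by rw [← hw, ← hq]; abel
  obtain ⟨w', hw'⟩ := defined_right h1
  rw [hw'] at h1
  have hpw : p ≤ w' := le_of_add_le_add hp h1 huw
  obtain ⟨z, hz⟩ : Orth q p := (le_compl_iff.1 hwu).mono
    ((le_of_add' hq).trans (le_of_add hw)) (le_of_add' hp)
  obtain ⟨j, hqj, hpj, hj⟩ := hL.exists_sup q p
  obtain ⟨k, hk⟩ := le_iff.1 (hj z (le_of_add hz) (le_of_add' hz))
  have hk0 : k = 0 := hd k
    (le_of_add_eq_of_le hz hk hqj) (le_of_add_eq_of_le (by rw [add_comm, hz]) hk hpj)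
  rw [hk0, coe_zero, add_zero] at hk
  have hzw : z ≤ w' := by
    rw [← coe_inj.1 hk]
    exact hj w' (le_of_add hw') hpw
  exact ⟨m, p, le_of_add hq, le_of_add_le_add hz hw' hzw, hp⟩

/-- With `a = s ⊖ x`, the join of `y` and `a` is below both `s` and `x' = a ⊕ s'`. Its excess over
`a` is therefore below `s` and `s'`, so `y ≤ a`. -/
theorem IsLatticeEA.add_le_sharp (hL : IsLatticeEA E) {s x y z : E} (hs : s ∈ Sh E)
    (hx : x ≤ s) (hy : y ≤ s) (h : (x : Tot E) + y = z) : z ≤ s := by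
  obtain ⟨a, ha⟩ := le_iff.1 hx
  obtain ⟨j, hyj, haj, hj⟩ := hL.exists_sup y a
  have hax : (a : Tot E) + (compl s : E) = (compl x : E) := by
    refine tot_cancel (a := x) (z := 1) ?_ (coe_add_compl x)
    rw [← add_assoc, ha, coe_add_compl]
  have hjs := hj s hy (le_of_add' ha)
  obtain ⟨d, hd⟩ := le_iff.1 haj
  have hdx : d ≤ x := le_of_add_le_add hd (by rw [add_comm, ha]) hjs
  have hds : d ≤ compl s := le_of_add_le_add hd hax
    (hj _ (le_compl_iff.2 (Orth.symm ⟨z, h⟩)) (le_of_add hax))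
  have hd0 : d = 0 := eq_zero_of_sharp hs (hdx.trans hx) (le_compl_iff.1 hds)
  rw [hd0, coe_zero, add_zero] at hd
  rw [← coe_inj.1 hd] at hyj
  exact sum_le_sum le_rfl hyj h ha

/-- The largest multiple `z` of `a` below `x` is sharp: a nonzero element below `z` and `z'` would
lie above `a`, and one more copy of `a` would fit between `z` and `x`. -/
theorem exists_sharp_of_atom (hH : IsHomogeneous E) (hA : IsArchimedeanEA E) {a x : E}
    (ha : Minimal (fun y : E => y ≠ 0) a) (hax : a ≤ x) (hd : Disj a (compl x)) :
    ∃ s ∈ Sh E, a ≤ s ∧ s ≤ x := by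
  classical
  have hex : ∃ n : ℕ, ¬ ∃ z : E, n • (a : Tot E) = z ∧ z ≤ x := by
    obtain ⟨n, hn⟩ := hA a ha.1
    refine ⟨n, ?_⟩
    rintro ⟨z, hz, -⟩
    have h1 := listSum_eq_tsum (List.replicate n a)
    rw [hn, Multiset.coe_replicate, tsum, Multiset.map_replicate, Multiset.sum_replicate, hz] at h1
    cases h1
  obtain ⟨k, hk⟩ : ∃ k, Nat.find hex = k + 1 := by
    refine Nat.exists_eq_succ_of_ne_zero fun h0 => ?_
    have := Nat.find_spec hex
    rw [h0] at this
    exact this ⟨0, by rw [zero_nsmul, coe_zero], zero_le x⟩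
  have hk1 : ¬ ∃ z : E, (k + 1) • (a : Tot E) = z ∧ z ≤ x := hk ▸ Nat.find_spec hex
  obtain ⟨z, hz, hzx⟩ : ∃ z : E, k • (a : Tot E) = z ∧ z ≤ x :=
    not_not.1 (Nat.find_min hex (by omega))
  have hkpos : k ≠ 0 := by
    rintro rfl
    exact hk1 ⟨a, by rw [zero_add, one_nsmul], hax⟩
  have haz : a ≤ z := by
    obtain ⟨j, rfl⟩ := Nat.exists_eq_succ_of_ne_zero hkpos
    rw [succ_nsmul] at hz
    exact le_of_add' hz
  refine ⟨z, mem_Sh_iff.2 fun c hc hc' => ?_, haz, hzx⟩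
  by_contra hc0
  have hcz := le_compl_iff.1 hc'
  obtain ⟨d, hd0, hdc, r, hr, hdr⟩ := hH.exists_piece (L := Multiset.replicate k a)
    (by rw [tsum, Multiset.map_replicate, Multiset.sum_replicate, hz]) hc hcz.symm hc0
  rw [Multiset.eq_of_mem_replicate hr] at hdr
  have hac : a ≤ c := (ha.2 hd0 hdr).trans hdc
  obtain ⟨l, hl⟩ := le_iff.1 hzx
  have h1 : ((compl x : E) : Tot E) + l = (compl z : E) := by
    refine tot_cancel (a := z) (z := 1) ?_ (coe_add_compl z)
    rw [← coe_add_compl x, ← hl]; abel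
  have hal : a ≤ l := hH.le_right h1 (hac.trans hc')
    ((le_compl_iff.1 (le_refl (compl z))).mono le_rfl haz) hd
  obtain ⟨e, he⟩ : Orth z a := Orth.mono ⟨x, hl⟩ le_rfl hal
  exact hk1 ⟨e, by rw [succ_nsmul, hz, he], sum_le_sum le_rfl hal he hl⟩

theorem IsLatticeEA.isTame (hL : IsLatticeEA E) (hS : IsSharplyDominating E)
    (hA : IsArchimedeanEA E) (hAt : IsAtomicEA E) : IsTame E where
  hom := hL.isHomogeneous
  sd := hS
  exists_disj x y := by
    obtain ⟨m, p, q, h1, h2, h3, -⟩ := hL.exists_inf x y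
    exact ⟨m, p, q, h1, h2, h3⟩
  exists_sharp u x hux hd := by
    obtain ⟨s, hs⟩ := hS.exists_isFloor x
    refine ⟨s, hs.1, ?_, hs.2.1⟩
    obtain ⟨m, e, q, he, hq, -, hm⟩ := hL.exists_inf u s
    -- An atom `a` below the part of `u` outside `u ∧ x̃` lies below `x̃`, and so does its sum with
    -- `u ∧ x̃`; that sum is also below `u`, contradicting the meet.
    have he0 : e = 0 := by
      by_contra h0
      obtain ⟨a, ha, hae⟩ := hAt e h0
      have hau := hae.trans (le_of_add' he)
      obtain ⟨σ, hσ, haσ, hσx⟩ := exists_sharp_of_atom hL.isHomogeneous hA ha (hau.trans hux)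
        (hd.mono hau le_rfl)
      obtain ⟨z, hz⟩ : Orth m a := Orth.mono ⟨u, he⟩ le_rfl hae
      have hzs := hL.add_le_sharp hs.1 (le_of_add hq) (haσ.trans (hs.2.2 σ hσ hσx)) hz
      have hzm : z = m := le_antisymm (hm z (sum_le_sum le_rfl hae hz he) hzs) (le_of_add hz)
      rw [hzm] at hz
      exact ha.1 (eq_zero_of_add_eq_self hz)
    rw [he0, coe_zero, add_zero] at he
    rw [← coe_inj.1 he]
    exact le_of_add hq

end Lattice

/-! ### Maximal orthosums; homogeneous orthocomplete effect algebras are tame -/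

section Orthocomplete

variable {E : Type u} [EffectAlgebra E]

/-- In an orthocomplete effect algebra there are maximal orthosums of elements of `D` bounded by
the elements of `Y`. -/
theorem IsOrthocomplete.exists_maximal_sum (hO : IsOrthocomplete E) (D Y : Set E)
    (hY : Y.Nonempty) : ∃ (z : E) (S : Set E), IsLUB S z ∧
      (∀ f ∈ S, ∃ L : Multiset E, (∀ d ∈ L, d ∈ D) ∧ tsum L = f) ∧ (∀ y ∈ Y, z ≤ y) ∧
      ∀ c ∈ D, (∀ y ∈ Y, ∃ e : E, (z : Tot E) + c = e ∧ e ≤ y) → c = 0 := by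
  -- The second coordinate in `E × ℕ` serves as a label that allows an element to occur repeatedly,
  -- even infinitely often.
  obtain ⟨A, -, hA⟩ := zorn_subset_nonempty {A : Set (E × ℕ) | (∀ p ∈ A, p.1 ∈ D) ∧
      ∀ l : List (E × ℕ), l.Nodup → (∀ p ∈ l, p ∈ A) →
        ∃ w : E, tsum (l.map Prod.fst : Multiset E) = w ∧ ∀ y ∈ Y, w ≤ y}
    (fun c hc hch hne => by
      refine ⟨⋃₀ c, ⟨?_, fun l hl hlA => ?_⟩, fun s hs => Set.subset_sUnion_of_mem hs⟩
      · rintro p ⟨B, hB, hp⟩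
        exact (hc hB).1 p hp
      · obtain ⟨B, hB, hlB⟩ := DirectedOn.exists_mem_subset_of_finite_of_subset_sUnion hne
          hch.directedOn l.finite_toSet hlA
        exact (hc hB).2 l hl hlB)
    ∅ ⟨fun p hp => absurd hp (Set.notMem_empty p), fun l _ hl => by
      rw [List.eq_nil_iff_forall_not_mem.2 hl]
      exact ⟨0, rfl, fun y _ => zero_le y⟩⟩
  obtain ⟨hAD, hAs⟩ := hA.1
  set x : A → E := fun i => i.1.1 with hx
  have hmap : ∀ l : List A, listSum (l.map x) = tsum ((l.map Subtype.val).map Prod.fst :) := by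
    intro l
    rw [List.map_map]
    exact listSum_eq_tsum _
  have hfin : ∀ l : List A, l.Nodup → ∃ w : E, listSum (l.map x) = some w ∧ ∀ y ∈ Y, w ≤ y := by
    intro l hl
    obtain ⟨w, hw, hwY⟩ := hAs (l.map Subtype.val) (hl.map Subtype.val_injective)
      (fun p hp => by
        obtain ⟨i, -, rfl⟩ := List.mem_map.1 hp
        exact i.2)
    exact ⟨w, (hmap l).trans hw, hwY⟩
  have hbd : ∀ y ∈ Y, y ∈ upperBounds (finiteSums x) := by
    rintro y hy f ⟨l, hl, hf⟩
    obtain ⟨w, hw, hwY⟩ := hfin l hl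
    rw [Option.some.inj (hf.symm.trans hw)]
    exact hwY y hy
  obtain ⟨z, hz⟩ := hO A x (fun l hl => (hfin l hl).imp fun _ h => h.1)
    ⟨_, hbd _ hY.some_mem⟩
  have hzY : ∀ y ∈ Y, z ≤ y := fun y hy => hz.2 (hbd y hy)
  have hsum : ∀ l : List (E × ℕ), l.Nodup → (∀ p ∈ l, p ∈ A) → ∀ w : E,
      tsum (l.map Prod.fst : Multiset E) = w → w ≤ z := by
    intro l hl hlA w hw
    lift l to List A using hlA
    exact hz.1 ⟨l, List.Nodup.of_map _ hl, (hmap l).trans hw⟩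
  refine ⟨z, finiteSums x, hz, ?_, hzY, fun c hc hcY => ?_⟩
  · rintro f ⟨l, -, hf⟩
    refine ⟨(l.map x : List E), fun d hd => ?_, (listSum_eq_tsum _).symm.trans hf⟩
    obtain ⟨i, -, rfl⟩ := List.mem_map.1 (Multiset.mem_coe.1 hd)
    exact hAD _ i.2
  · obtain ⟨y₀, hy₀⟩ := hY
    obtain ⟨e₀, he₀, -⟩ := hcY y₀ hy₀
    -- If `c` can still be added to the supremum, maximality of `A` forces every labelled copy of
    -- `c` into `A`.
    have hall : ∀ n, (c, n) ∈ A := by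
      intro n
      refine hA.2 (y := insert (c, n) A) ⟨?_, fun l hl hlA => ?_⟩ (Set.subset_insert _ A)
        (Set.mem_insert _ A)
      · rintro p (rfl | hp)
        · exact hc
        · exact hAD p hp
      · by_cases hcl : (c, n) ∈ l
        · classical
          have hperm := List.perm_cons_erase hcl
          obtain ⟨w, hw, -⟩ := hAs (l.erase (c, n)) (hl.erase _) fun p hp => by
            rcases hlA p (List.mem_of_mem_erase hp) with rfl | hp'
            · exact absurd rfl ((List.Nodup.mem_erase_iff hl).1 hp).1
            · exact hp'
          have hwz := hsum _ (hl.erase _) (fun p hp => by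
            rcases hlA p (List.mem_of_mem_erase hp) with rfl | hp'
            · exact absurd rfl ((List.Nodup.mem_erase_iff hl).1 hp).1
            · exact hp') w hw
          have h1 : tsum (l.map Prod.fst : Multiset E) = (c : Tot E) + w := by
            rw [Multiset.coe_eq_coe.2 (hperm.map Prod.fst), List.map_cons, ← Multiset.cons_coe,
              tsum_cons, hw]
          obtain ⟨f, hf⟩ : Orth w c := Orth.mono ⟨e₀, he₀⟩ hwz le_rfl
          refine ⟨f, by rw [h1, add_comm, hf], fun y hy => ?_⟩
          obtain ⟨e, he, hey⟩ := hcY y hy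
          exact (sum_le_sum hwz le_rfl hf he).trans hey
        · exact hAs l hl fun p hp => (hlA p hp).resolve_left fun h => hcl (h ▸ hp)
    have hcz : c ≤ z := hsum [(c, 0)] (List.nodup_singleton _)
      (fun p hp => by rw [List.mem_singleton.1 hp]; exact hall 0) c (tsum_singleton c)
    obtain ⟨k, hk⟩ := le_iff.1 hcz
    -- Every finite sum leaves some copy of `c` unused and so can be enlarged by `c`. Hence all
    -- finite sums lie below `z ⊖ c`.
    have hzk : z ≤ k := by
      refine hz.2 ?_
      rintro f ⟨l, hl, hf⟩
      have hinj : Function.Injective fun n : ℕ => (c, n) := fun a b h => congrArg Prod.snd h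
      obtain ⟨p, ⟨n, rfl⟩, hn⟩ := (Set.infinite_range_of_injective hinj).exists_notMem_finite
        (l.map Subtype.val).finite_toSet
      have hmem : ∀ p ∈ (c, n) :: l.map Subtype.val, p ∈ A := by
        intro p hp
        rcases List.mem_cons.1 hp with rfl | hp
        · exact hall n
        · obtain ⟨i, -, rfl⟩ := List.mem_map.1 hp
          exact i.2
      have hnd : ((c, n) :: l.map Subtype.val).Nodup :=
        List.nodup_cons.2 ⟨hn, hl.map Subtype.val_injective⟩
      obtain ⟨w, hw, -⟩ := hAs _ hnd hmem
      have hwz := hsum _ hnd hmem w hw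
      rw [List.map_cons, ← Multiset.cons_coe, tsum_cons, (hmap l).symm.trans hf] at hw
      exact le_of_add_le_add hw hk hwz
    have hkz : k = z := le_antisymm (le_of_add' hk) hzk
    rw [hkz, add_comm] at hk
    exact eq_zero_of_add_eq_self hk

/-- In the homogeneous case moreover each nonzero `c` below a maximal orthosum and orthogonal to it
has a nonzero part below an element of `D`. -/
theorem IsHomogeneous.exists_maximal_sum (hH : IsHomogeneous E) (hO : IsOrthocomplete E)
    (D Y : Set E) (hY : Y.Nonempty) : ∃ z : E, (∀ y ∈ Y, z ≤ y) ∧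
      (∀ c, c ≤ z → Orth z c → c ≠ 0 → ∃ d, d ≠ 0 ∧ d ≤ c ∧ ∃ r ∈ D, d ≤ r) ∧
      (∀ b, (∀ (L : Multiset E) (f : E), (∀ d ∈ L, d ∈ D) → tsum L = f → f ≤ z → f ≤ b) →
        z ≤ b) ∧
      ∀ c ∈ D, (∀ y ∈ Y, ∃ e : E, (z : Tot E) + c = e ∧ e ≤ y) → c = 0 := by
  obtain ⟨z, S, hz, hS, hzY, hmax⟩ := hO.exists_maximal_sum D Y hY
  refine ⟨z, hzY, fun c hc ho h0 => ?_, fun b hb => ?_, hmax⟩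
  · by_contra hcon
    refine h0 ?_
    obtain ⟨k, hk⟩ := le_iff.1 hc
    -- If no nonzero part of `c` lies below a member of `D`, then `c` is disjoint from each finite
    -- sum `f`. Homogeneity gives `c ≤ z ⊖ f`, that is, `f ≤ z ⊖ c`.
    have hzk : z ≤ k := by
      refine hz.2 fun f hf => ?_
      obtain ⟨g, hg⟩ := le_iff.1 (hz.1 hf)
      obtain ⟨L, hL, hLf⟩ := hS f hf
      refine le_of_add_eq_of_le hk (by rw [add_comm, hg]) (hH.le_right hg hc ho ?_)
      intro d hdc hdf
      by_contra hd0
      obtain ⟨d', h1, h2, r, hr, h3⟩ := hH.exists_piece hLf hdf (ho.mono (hz.1 hf) hdc) hd0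
      exact hcon ⟨d', h1, h2.trans hdc, r, hL r hr, h3⟩
    have hkz : k = z := le_antisymm (le_of_add' hk) hzk
    rw [hkz, add_comm] at hk
    exact eq_zero_of_add_eq_self hk
  · refine hz.2 fun f hf => ?_
    obtain ⟨L, hL, hLf⟩ := hS f hf
    exact hb L f hL hLf (hz.1 hf)

theorem IsHomogeneous.tsum_le_of_sharp (hH : IsHomogeneous E) {s x : E} (hs : s ∈ Sh E)
    (L : Multiset E) (hL : ∀ d ∈ L, Orth d x) {k b f : E} (hk : (s : Tot E) + k = b)
    (hb : b ≤ x) (hf : tsum L = f) (hfb : f ≤ b) : f ≤ k := by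
  induction L using Multiset.induction generalizing k b f with
  | empty =>
    rw [← coe_inj.1 hf]
    exact zero_le k
  | cons d L ih =>
    rw [tsum_cons] at hf
    obtain ⟨f', hf'⟩ := defined_right hf
    rw [hf'] at hf
    have hdx := hL d (Multiset.mem_cons_self d L)
    have hdk : d ≤ k := hH.le_right hk ((le_of_add hf).trans hfb) (hdx.symm.mono hb le_rfl)
      fun e h1 h2 => eq_zero_of_sharp hs h2 (hdx.mono h1 ((le_of_add hk).trans hb))
    obtain ⟨k', hk'⟩ := le_iff.1 hdk
    have h1 : (d : Tot E) + (s + k') = b := by rw [← hk, ← hk']; abel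
    obtain ⟨b', hb'⟩ := defined_right h1
    rw [hb'] at h1
    exact sum_le_sum le_rfl (ih (fun x hx => hL x (Multiset.mem_cons_of_mem hx)) hb'
      ((le_of_add' h1).trans hb) hf' (le_of_add_le_add hf h1 hfb)) hf hk'

/-- Subtract from `x` a maximal orthosum `z` of elements below `x` and orthogonal to `x`. Maximality
leaves no such nonzero element below the rest `t`, which makes `t` sharp. For sharp `s ≤ x` all the
partial sums fit below `x ⊖ s`, whence `s ≤ t`. -/
theorem IsHomogeneous.exists_isFloor (hH : IsHomogeneous E) (hO : IsOrthocomplete E) (x : E) :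
    ∃ t, IsFloor x t := by
  obtain ⟨z, hzx, hpiece, hlub, hmax⟩ := hH.exists_maximal_sum hO {c | c ≤ x ∧ Orth c x} {x}
    (Set.singleton_nonempty x)
  have hzx := hzx x rfl
  obtain ⟨t, ht⟩ := le_iff.1 hzx
  have hzero : ∀ d, d ≤ t → Orth d x → d = 0 := by
    intro d hdt hdx
    refine hmax d ⟨hdt.trans (le_of_add' ht), hdx⟩ ?_
    rintro y rfl
    obtain ⟨e, he⟩ : Orth z d := Orth.mono ⟨y, ht⟩ le_rfl hdt
    exact ⟨e, he, sum_le_sum le_rfl hdt he ht⟩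
  refine ⟨t, mem_Sh_iff.2 fun c hct hct' => ?_, le_of_add' ht, fun s hs hsx => ?_⟩
  · by_contra hc0
    have h1 : ((compl x : E) : Tot E) + z = (compl t : E) := by
      refine tot_cancel (a := t) (z := 1) ?_ (coe_add_compl t)
      rw [← coe_add_compl x, ← ht]; abel
    have hcz : c ≤ z := hH.le_right h1 hct'
      ((le_compl_iff.1 (le_refl (compl t))).mono le_rfl hct)
      fun d hd hd' => hzero d (hd.trans hct) (le_compl_iff.1 hd')
    obtain ⟨d, hd0, hdc, r, hr, hdr⟩ := hpiece c hcz (Orth.mono ⟨x, ht⟩ le_rfl hct) hc0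
    exact hd0 (hzero d (hdc.trans hct) (hr.2.mono hdr le_rfl))
  · obtain ⟨k, hk⟩ := le_iff.1 hsx
    have hzk : z ≤ k := hlub k fun L f hL hf hfz =>
      hH.tsum_le_of_sharp hs L (fun d hd => (hL d hd).2) hk le_rfl hf (hfz.trans hzx)
    exact le_of_add_eq_of_le ht (by rw [add_comm, hk]) hzk

theorem IsHomogeneous.isTame (hH : IsHomogeneous E) (hO : IsOrthocomplete E) : IsTame E where
  hom := hH
  sd := isSharplyDominating_iff.2 fun x => by
    obtain ⟨t, ht⟩ := hH.exists_isFloor hO (compl x)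
    exact ⟨compl t, by simpa only [compl_compl] using ht.compl_isCeil⟩
  exists_disj x y := by
    obtain ⟨z, hz, -, -, hmax⟩ := hH.exists_maximal_sum hO Set.univ {x, y}
      (Set.insert_nonempty x {y})
    obtain ⟨p, hp⟩ := le_iff.1 (hz x (by simp))
    obtain ⟨q, hq⟩ := le_iff.1 (hz y (by simp))
    refine ⟨z, p, q, hp, hq, fun c hcp hcq => hmax c trivial ?_⟩
    obtain ⟨e, he⟩ : Orth z c := Orth.mono ⟨x, hp⟩ le_rfl hcp
    rintro w (rfl | rfl)
    · exact ⟨e, he, sum_le_sum le_rfl hcp he hp⟩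
    · exact ⟨e, he, sum_le_sum le_rfl hcq he hq⟩
  exists_sharp u x hux hd := by
    obtain ⟨v, hv⟩ := le_iff.1 hux
    -- The sharp element is `u ⊕ z₀`, with `z₀` a maximal orthosum of elements below `u` inside `x ⊖
    -- u`. A failure of sharpness would produce another nonzero summand.
    obtain ⟨z₀, hz₀, hpiece, -, hmax⟩ := hH.exists_maximal_sum hO (Set.Iic u) {v}
      (Set.singleton_nonempty v)
    obtain ⟨l, hl⟩ := le_iff.1 (hz₀ v rfl)
    have h1 : (u : Tot E) + z₀ + l = x := by rw [← hv, ← hl]; abel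
    obtain ⟨z, hz⟩ := defined_left h1
    rw [hz] at h1
    refine ⟨z, mem_Sh_iff.2 fun c hcz hcz' => ?_, le_of_add hz, le_of_add h1⟩
    by_contra hc0
    have ho := (le_compl_iff.1 hcz').symm
    obtain ⟨d, hd0, hdc, hdu⟩ : ∃ d, d ≠ 0 ∧ d ≤ c ∧ d ≤ u := by
      by_cases h0 : Disj c u
      · have hcz₀ := hH.le_right hz hcz ho h0
        obtain ⟨d, h2, h3, r, hr, h4⟩ := hpiece c hcz₀ (ho.mono (le_of_add' hz) le_rfl) hc0
        exact ⟨d, h2, h3, h4.trans hr⟩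
      · unfold Disj at h0
        push Not at h0
        obtain ⟨d, h2, h3, h4⟩ := h0
        exact ⟨d, h4, h2, h3⟩
    have h2 : ((compl x : E) : Tot E) + l = (compl z : E) := by
      refine tot_cancel (a := z) (z := 1) ?_ (coe_add_compl z)
      rw [← coe_add_compl x, ← h1]; abel
    have hdl : d ≤ l := hH.le_right h2 (hdc.trans hcz')
      ((le_compl_iff.1 (le_refl (compl z))).mono le_rfl (hdc.trans hcz)) (hd.mono hdu le_rfl)
    refine hd0 (hmax d hdu ?_)
    rintro y rfl
    obtain ⟨e, he⟩ : Orth z₀ d := Orth.mono ⟨y, hl⟩ le_rfl hdl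
    exact ⟨e, he, sum_le_sum le_rfl hdl he hl⟩

theorem IsCompleteLatticeEA.isLatticeEA (h : IsCompleteLatticeEA E) : IsLatticeEA E :=
  fun _ _ => h _

theorem IsCompleteLatticeEA.isOrthocomplete (h : IsCompleteLatticeEA E) : IsOrthocomplete E :=
  fun _ _ _ _ => (h _).2

end Orthocomplete

/-! ### Transport of structure and induced isomorphisms of triples -/

section Transport

variable {E : Type u} {F : Type v} [EffectAlgebra E] [EffectAlgebra F]

/-- The effect algebra structure on a type `X` obtained from a bijection with `E`. -/
@[reducible] def transport {X : Type v} (e : X ≃ E) : EffectAlgebra X where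
  zero := e.symm 0
  one := e.symm 1
  oplus x y := (oplus (e x) (e y)).map e.symm
  zero_ne_one h := zero_ne_one (e.symm.injective h)
  oplus_comm x y := by rw [oplus_comm]
  oplus_assoc x y z := by
    simp only [Option.bind_map, Function.comp_def, Equiv.apply_symm_apply]
    exact (Option.map_bind.symm.trans (congrArg (Option.map e.symm) (oplus_assoc _ _ _))).trans
      Option.map_bind
  exists_unique_compl x := by
    refine ⟨e.symm (compl (e x)), ?_, fun y hy => ?_⟩
    · change (oplus (e x) (e (e.symm (compl (e x))))).map e.symm = some (e.symm 1)
      rw [Equiv.apply_symm_apply, oplus_compl, Option.map_some]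
    · obtain ⟨z, hz, hz1⟩ := Option.map_eq_some_iff.1
        (show (oplus (e x) (e y)).map e.symm = some (e.symm 1) from hy)
      rw [e.symm.injective hz1] at hz
      rw [← eq_compl hz, Equiv.symm_apply_apply]
  eq_zero_of_one_oplus x y hxy := by
    obtain ⟨z, hz, -⟩ := Option.map_eq_some_iff.1
      (show (oplus (e (e.symm 1)) (e x)).map e.symm = some y from hxy)
    rw [Equiv.apply_symm_apply] at hz
    exact e.eq_symm_apply.2 (eq_zero_of_one_oplus _ _ hz)

theorem transport_oplus_iff {X : Type v} (e : X ≃ E) (x y z : X) :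
    (transport e).oplus x y = some z ↔ oplus (e x) (e y) = some (e z) := by
  change (oplus (e x) (e y)).map e.symm = some z ↔ _
  rw [Option.map_eq_some_iff]
  constructor
  · rintro ⟨w, hw, rfl⟩
    rwa [Equiv.apply_symm_apply]
  · intro h
    exact ⟨e z, h, e.symm_apply_apply z⟩

theorem isIsomorphism_iff (e : E ≃ F) : IsIsomorphism e ↔
    ∀ x y z : E, oplus x y = some z ↔ oplus (e x) (e y) = some (e z) := by
  constructor
  · refine fun he x y z => ⟨he.1.2 x y z, fun h => ?_⟩
    simpa only [Equiv.symm_apply_apply] using he.2.2 _ _ _ h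
  · intro he
    -- Pulling back `e 1 ⊕ (e 1)' = 1` shows that `(e 1)'` is `e 0`, while `e 1 ⊕ e 0 = e 1`.
    have h1 : e 1 = 1 := by
      have h2 : oplus (e 1) (e (e.symm (compl (e 1)))) = some (e (e.symm 1)) := by
        rw [Equiv.apply_symm_apply, Equiv.apply_symm_apply, oplus_compl]
      have h3 := eq_zero_of_one_oplus _ _ ((he _ _ _).2 h2)
      rw [h3, (he _ _ _).1 (oplus_zero (1 : E)), Equiv.apply_symm_apply] at h2
      exact Option.some.inj h2
    refine ⟨⟨h1, fun x y z => (he x y z).1⟩, ?_, fun x y z h => ?_⟩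
    · rw [← h1, Equiv.symm_apply_apply]
    · rw [he]
      simpa only [Equiv.apply_symm_apply] using h

theorem IsIsomorphism.le_iff {e : E ≃ F} (he : IsIsomorphism e) {x y : E} :
    e x ≤ e y ↔ x ≤ y := by
  have key := (isIsomorphism_iff e).1 he
  constructor
  · rintro ⟨z, hz⟩
    exact ⟨e.symm z, (key _ _ _).2 (by rwa [Equiv.apply_symm_apply])⟩
  · rintro ⟨z, hz⟩
    exact ⟨e z, (key _ _ _).1 hz⟩

theorem IsIsomorphism.map_compl {e : E ≃ F} (he : IsIsomorphism e) (x : E) :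
    e (compl x) = compl (e x) := by
  refine eq_compl ?_
  rw [← he.1.1]
  exact he.1.2 _ _ _ (oplus_compl x)

theorem IsIsomorphism.map_zero {e : E ≃ F} (he : IsIsomorphism e) : e 0 = 0 := by
  rw [← compl_one, he.map_compl, he.1.1, compl_one]

theorem IsIsomorphism.mem_Sh_iff {e : E ≃ F} (he : IsIsomorphism e) (x : E) :
    x ∈ Sh E ↔ e x ∈ Sh F := by
  rw [EffectAlgebra.mem_Sh_iff, EffectAlgebra.mem_Sh_iff, Disj, Disj, e.surjective.forall]
  simp only [← he.map_compl, he.le_iff, ← he.map_zero, e.injective.eq_iff]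

theorem IsIsomorphism.mem_Mea_iff {e : E ≃ F} (he : IsIsomorphism e) (x : E) :
    x ∈ Mea E ↔ e x ∈ Mea F := by
  change (∀ s ∈ Sh E, s ≤ x → s = 0) ↔ ∀ s ∈ Sh F, s ≤ e x → s = 0
  rw [e.surjective.forall]
  simp only [← he.mem_Sh_iff, he.le_iff, ← he.map_zero, e.injective.eq_iff]

/-- An isomorphism of effect algebras induces an isomorphism of their triples. -/
def IsIsomorphism.tripleIso {e : E ≃ F} (he : IsIsomorphism e) : TripleIso E F where
  shEquiv := e.subtypeEquiv he.mem_Sh_iff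
  meaEquiv := e.subtypeEquiv he.mem_Mea_iff
  map_one s hs := by
    change e (s : E) = 1
    rw [hs, he.1.1]
  sh_sum x y z := (isIsomorphism_iff e).1 he x y z
  mea_sum x y z := (isIsomorphism_iff e).1 he x y z
  map_h s := by
    ext y
    obtain ⟨x, rfl⟩ := (e.subtypeEquiv he.mem_Mea_iff).surjective y
    rw [(e.subtypeEquiv he.mem_Mea_iff).injective.mem_set_image]
    exact he.le_iff.symm

end Transport

/-! ### The triple representation theorem for TRT-effect algebras -/

section Triple

variable {E : Type u} [EffectAlgebra E]

theorem Tea.exists_add (p : Tea E) :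
    ∃ x : E, ((p.sharp : E) : Tot E) + (p.meager : E) = x :=
  Orth.symm (le_compl_iff.1 (show (p.meager : E) ≤ compl (p.sharp : E) from p.mem))

/-- The element of `E` represented by an element of `T(E)`. -/
noncomputable def Tea.val (p : Tea E) : E := p.exists_add.choose

theorem Tea.add_eq_val (p : Tea E) :
    ((p.sharp : E) : Tot E) + (p.meager : E) = (p.val : E) := p.exists_add.choose_spec

theorem Tea.ext' {p q : Tea E} (h1 : (p.sharp : E) = q.sharp) (h2 : (p.meager : E) = q.meager) :
    p = q := by
  obtain ⟨s, m, hp⟩ := p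
  obtain ⟨t, n, hq⟩ := q
  obtain rfl : s = t := Subtype.ext h1
  obtain rfl : m = n := Subtype.ext h2
  rfl

theorem IsTRT.isFloor_val (hE : IsTRT E) (p : Tea E) : IsFloor p.val (p.sharp : E) :=
  hE.homogeneous.isFloor_of_mea hE.sharplyDominating p.sharp.2 p.meager.2 p.add_eq_val

theorem IsTRT.bijective_val (hE : IsTRT E) : Function.Bijective (Tea.val : Tea E → E) := by
  constructor
  · intro p q h
    have h1 : (p.sharp : E) = q.sharp := (hE.isFloor_val p).eq (h ▸ hE.isFloor_val q)
    refine Tea.ext' h1 (coe_cancel p.add_eq_val ?_)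
    rw [h1, h]
    exact q.add_eq_val
  · intro x
    obtain ⟨t, ht⟩ := hE.sharplyDominating.exists_isFloor x
    obtain ⟨m, hm⟩ := le_iff.1 ht.2.1
    refine ⟨⟨⟨t, ht.1⟩, ⟨m, hE.homogeneous.mea_of_isFloor ht hm⟩,
      le_compl_iff.2 (Orth.symm ⟨x, hm⟩)⟩, coe_inj.1 ?_⟩
    rw [← Tea.add_eq_val]
    exact hm

theorem add_of_teaSum {p q r : Tea E} (h : TeaSum p q r) :
    (p.val : Tot E) + q.val = r.val := by
  obtain ⟨s, hs, ⟨k, hk, hks⟩, a, b, c, d, ha, hb, hac, hbd, hcd⟩ := h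
  obtain ⟨-, a', b', ha', hb', hab⟩ := hs.1
  rw [ha'.unique ha, hb'.unique hb] at hab
  have hk : ((p.sharp : E) : Tot E) + (q.sharp : E) = (k : E) := hk
  have hks : ((k : E) : Tot E) + (s : E) = (r.sharp : E) := hks
  have hac : ((a : E) : Tot E) + (c : E) = (p.meager : E) := hac
  have hbd : ((b : E) : Tot E) + (d : E) = (q.meager : E) := hbd
  have hcd : ((c : E) : Tot E) + (d : E) = (r.meager : E) := hcd
  have hab : ((a : E) : Tot E) + (b : E) = (s : E) := hab
  rw [← p.add_eq_val, ← q.add_eq_val, ← r.add_eq_val, ← hks, ← hcd, ← hk, ← hab, ← hac, ← hbd]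
  abel

/-- The block contains `[0, x]`, so a common lower bound of `t` and `x` splits along `a ⊕ c`; its
part below `c` is orthogonal to `t` and below `t`. -/
theorem IsTRT.isGLB_of_isBlock (hE : IsTRT E) {B : Set E} (hB : IsBlock B) {x a c t : E}
    (hx : x ∈ Mea E) (hxB : x ∈ B) (haB : a ∈ B) (ht : t ∈ Sh E) (hat : a ≤ t)
    (hac : (a : Tot E) + c = x) (hct : Orth c t) : IsGLB {t, x} a := by
  refine isGLB_pair_iff.2 ⟨⟨hat, le_of_add hac⟩, fun z hzt hzx => ?_⟩
  have hzB : z ∈ B := hE.interval_subset B hB x hxB 0 (isFloor_zero_of_mea hx).isTilde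
    ⟨zero_le z, hzx⟩
  obtain ⟨z₁, -, z₂, -, h1, h2, h3⟩ := hB.1.2 z hzB a haB c (hB.1.1.sub_mem haB hxB hac) x hxB
    hac hzx
  have h3 : (z₁ : Tot E) + z₂ = z := h3
  have h0 : z₂ = 0 := eq_zero_of_sharp ht ((le_of_add' h3).trans hzt) (hct.mono h2 le_rfl)
  rw [h0, coe_zero, add_zero] at h3
  rwa [← coe_inj.1 h3]

theorem IsTRT.teaSum_of_add (hE : IsTRT E) {p q r : Tea E}
    (h : (p.val : Tot E) + q.val = r.val) : TeaSum p q r := by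
  have hH := hE.homogeneous
  have h1 : ((p.sharp : E) : Tot E) + (q.sharp : E) + ((p.meager : E) + (q.meager : E)) =
      r.val := by
    rw [← h, ← p.add_eq_val, ← q.add_eq_val]; abel
  obtain ⟨w, hw⟩ := defined_right h1
  obtain ⟨B, hB, hpB, hqB⟩ := hH.exists_isBlock hw
  have hwB := hB.1.1.add_mem hpB hqB hw
  obtain ⟨t, ht⟩ := hE.sharplyDominating.exists_isFloor w
  have htB : t ∈ B := hE.interval_subset B hB w hwB t ht.isTilde ⟨le_rfl, ht.2.1⟩
  -- Splitting `t = w̃` inside the block yields its meets with the meager parts. Any other member of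
  -- `sharpSplit` is a sharp element below `w`, so `t` is the greatest.
  obtain ⟨a, haB, b, hbB, hap, hbq, hab⟩ := hB.1.2 t htB _ hpB _ hqB w hwB hw ht.2.1
  have hab : (a : Tot E) + b = t := hab
  obtain ⟨c, hc⟩ := le_iff.1 hap
  obtain ⟨d, hd⟩ := le_iff.1 hbq
  have h2 : (t : Tot E) + (c + d) = w := by rw [← hw, ← hc, ← hd, ← hab]; abel
  obtain ⟨n, hn⟩ := defined_right h2
  rw [hn] at h2
  have hnM : n ∈ Mea E := hH.mea_of_isFloor ht h2
  rw [hw, ← h2, ← add_assoc] at h1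
  obtain ⟨σ, hσ⟩ := defined_left h1
  obtain ⟨k, hk⟩ := defined_left hσ
  have hkS : k ∈ Sh E := hH.add_mem_Sh p.sharp.2 q.sharp.2 hk
  rw [hk] at hσ
  have hσS : σ ∈ Sh E := hH.add_mem_Sh hkS ht.1 hσ
  rw [hk, hσ] at h1
  have hσr : σ = r.sharp :=
    (hH.isFloor_of_mea hE.sharplyDominating hσS hnM h1).eq (hE.isFloor_val r)
  have hnr : n = r.meager := coe_cancel h1 (by rw [hσr, r.add_eq_val])
  have hap' := hE.isGLB_of_isBlock hB p.meager.2 hpB haB ht.1 (le_of_add hab) hc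
    (Orth.mono (Orth.symm ⟨w, h2⟩) (le_of_add hn) le_rfl)
  have hbq' := hE.isGLB_of_isBlock hB q.meager.2 hqB hbB ht.1 (le_of_add' hab) hd
    (Orth.mono (Orth.symm ⟨w, h2⟩) (le_of_add' hn) le_rfl)
  rw [hσr] at hσ
  rw [hnr] at hn
  refine ⟨⟨t, ht.1⟩, ⟨⟨ht.1, a, b, hap', hbq', hab⟩, ?_⟩, ⟨⟨k, hkS⟩, hk, hσ⟩,
    ⟨a, mea_of_le p.meager.2 hap⟩, ⟨b, mea_of_le q.meager.2 hbq⟩,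
    ⟨c, mea_of_le p.meager.2 (le_of_add' hc)⟩, ⟨d, mea_of_le q.meager.2 (le_of_add' hd)⟩,
    hap', hbq', hc, hd, hn⟩
  rintro z ⟨hz, a', b', ha', hb', hab'⟩
  exact ht.2.2 z hz (sum_le_sum (isGLB_pair_iff.1 ha').1.2 (isGLB_pair_iff.1 hb').1.2 hab' hw)

/-- The bijection `x ↦ (x̃, x ⊖ x̃)` of `E` onto `T(E)`. -/
noncomputable def IsTRT.equivTea (hE : IsTRT E) : E ≃ Tea E :=
  (Equiv.ofBijective Tea.val hE.bijective_val).symm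

theorem IsTRT.val_equivTea (hE : IsTRT E) (x : E) : (hE.equivTea x).val = x :=
  (Equiv.ofBijective Tea.val hE.bijective_val).apply_symm_apply x

theorem IsTRT.teaSum_iff (hE : IsTRT E) (x y z : E) :
    TeaSum (hE.equivTea x) (hE.equivTea y) (hE.equivTea z) ↔ oplus x y = some z := by
  have h : TeaSum (hE.equivTea x) (hE.equivTea y) (hE.equivTea z) ↔
      ((hE.equivTea x).val : Tot E) + (hE.equivTea y).val = (hE.equivTea z).val :=
    ⟨add_of_teaSum, hE.teaSum_of_add⟩
  rw [h, hE.val_equivTea, hE.val_equivTea, hE.val_equivTea]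
  exact Iff.rfl

theorem IsTRT.equivTea_spec (hE : IsTRT E) (x : E) : IsFloor x ((hE.equivTea x).sharp : E) ∧
    (((hE.equivTea x).sharp : E) : Tot E) + ((hE.equivTea x).meager : E) = x := by
  have h1 := hE.isFloor_val (hE.equivTea x)
  have h2 := (hE.equivTea x).add_eq_val
  rw [hE.val_equivTea] at h1 h2
  exact ⟨h1, h2⟩

/-- The triple representation theorem for TRT-effect algebras. -/
theorem IsTRT.exists_effectAlgebra_tea (hE : IsTRT E) : ∃ T : EffectAlgebra (Tea E),
    (∀ p q r : Tea E, T.oplus p q = some r ↔ TeaSum p q r) ∧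
    ((T.zero.sharp : E) = 0 ∧ (T.zero.meager : E) = 0) ∧
    ((T.one.sharp : E) = 1 ∧ (T.one.meager : E) = 0) ∧
    ∃ φ : E ≃ Tea E, (∀ x : E, IsTilde x ((φ x).sharp : E) ∧
      oplus ((φ x).sharp : E) ((φ x).meager : E) = some x) ∧ IsIsomorphism φ := by
  have hT : ∀ p q r : Tea E,
      (transport hE.equivTea.symm).oplus p q = some r ↔ TeaSum p q r := by
    intro p q r
    rw [transport_oplus_iff, ← hE.teaSum_iff]
    simp only [Equiv.apply_symm_apply]
  refine ⟨transport hE.equivTea.symm, hT, ?_, ?_, hE.equivTea, fun x =>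
    ⟨(hE.equivTea_spec x).1.isTilde, (hE.equivTea_spec x).2⟩, ?_⟩
  · have h := (hE.equivTea_spec 0).2
    exact ⟨le_zero (le_of_add h), le_zero (le_of_add' h)⟩
  · obtain ⟨h1, h2⟩ := hE.equivTea_spec 1
    have h3 : ((hE.equivTea 1).sharp : E) = 1 :=
      le_antisymm h1.2.1 (h1.2.2 1 one_mem_Sh le_rfl)
    exact ⟨h3, coe_cancel h2 (by rw [h3, coe_zero, add_zero])⟩
  · let _ := transport hE.equivTea.symm
    exact (isIsomorphism_iff _).2 fun x y z => by rw [hT, hE.teaSum_iff]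

end Triple

/-! ### Reconstruction from the triple -/

section TripleTransfer

variable {E : Type u} [EffectAlgebra E]

theorem IsHomogeneous.sh_le_iff (hH : IsHomogeneous E) (s t : Sh E) :
    (s : E) ≤ t ↔ ∃ k : Sh E, SubSum (Sh E) s k t :=
  ⟨fun ⟨k, hk⟩ => ⟨⟨k, hH.sub_mem_Sh s.2 t.2 hk⟩, hk⟩, fun ⟨k, hk⟩ => ⟨k, hk⟩⟩

theorem mea_le_iff (x y : Mea E) : (x : E) ≤ y ↔ ∃ d : Mea E, SubSum (Mea E) x d y :=
  ⟨fun ⟨d, hd⟩ => ⟨⟨d, mea_of_le y.2 (le_of_add' (coe_add_eq_iff.2 hd))⟩, hd⟩,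
    fun ⟨d, hd⟩ => ⟨d, hd⟩⟩

theorem IsSharplyDominating.isHat_mea_iff (hS : IsSharplyDominating E) (x : Mea E) (t : Sh E) :
    IsHat (x : E) (t : E) ↔ x ∈ h t ∧ ∀ s : Sh E, x ∈ h s → (t : E) ≤ s := by
  rw [hS.isHat_iff]
  exact ⟨fun H => ⟨H.2.1, fun s hs => H.2.2 s s.2 hs⟩,
    fun H => ⟨t.2, H.1, fun s hs hx => H.2 ⟨s, hs⟩ hx⟩⟩

theorem isGLB_mea_iff (x y m : Mea E) : IsGLB {(x : E), (y : E)} (m : E) ↔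
    ((m : E) ≤ x ∧ (m : E) ≤ y) ∧ ∀ c : Mea E, (c : E) ≤ x → (c : E) ≤ y → (c : E) ≤ m := by
  rw [isGLB_pair_iff]
  exact ⟨fun H => ⟨H.1, fun c => H.2 c⟩,
    fun H => ⟨H.1, fun c hx hy => H.2 ⟨c, mea_of_le x.2 hx⟩ hx hy⟩⟩

theorem isGLB_sh_mea_iff (s : Sh E) (x m : Mea E) : IsGLB {(s : E), (x : E)} (m : E) ↔
    (m ∈ h s ∧ (m : E) ≤ x) ∧ ∀ c : Mea E, c ∈ h s → (c : E) ≤ x → (c : E) ≤ m := by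
  rw [isGLB_pair_iff]
  exact ⟨fun H => ⟨H.1, fun c => H.2 c⟩,
    fun H => ⟨H.1, fun c hx hy => H.2 ⟨c, mea_of_le x.2 hy⟩ hx hy⟩⟩

theorem trtCondition_iff (x : Mea E) (t : Sh E) (y : Mea E) : TRTCondition x t y ↔
    IsHat (y : E) (t : E) ∧
    (∃ m d w : Mea E, IsGLB {(x : E), (y : E)} (m : E) ∧ SubSum (Mea E) m d y ∧
      SubSum (Mea E) x d w ∧ w ∈ h t) ∧
    ∀ z : Mea E, z ∈ h t → ((∃ w : Mea E, SubSum (Mea E) z x w ∧ w ∈ h t) ↔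
      ((z : E) ≤ (y : E) ∧ ∃ d : Mea E, SubSum (Mea E) z d y ∧ IsHat (d : E) (t : E))) :=
  ⟨fun H => ⟨H.1, H.2, H.3⟩, fun H => ⟨H.1, H.2.1, H.2.2⟩⟩

/-- The sharp elements that are the sum of their meets with `x` and `y`, expressed through the
triple. -/
theorem IsTRT.mem_sharpSplit_iff (hE : IsTRT E) (x y : Mea E) (z : Sh E) :
    (z : E) ∈ sharpSplit x y ↔ ∃ a b : Mea E, IsGLB {(z : E), (x : E)} (a : E) ∧
      IsGLB {(z : E), (y : E)} (b : E) ∧ IsHat (a : E) (z : E) ∧ TRTCondition a z b := by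
  constructor
  · rintro ⟨hz, a, b, ha, hb, hab⟩
    have haM := mea_of_le x.2 (isGLB_pair_iff.1 ha).1.2
    have hbM := mea_of_le y.2 (isGLB_pair_iff.1 hb).1.2
    have hab : (a : Tot E) + b = (z : E) := hab
    -- The hat of `a` is `z`, so `unique_residual` translates `a ⊕ b = z` into conditions on the
    -- triple.
    have hc := (hE.homogeneous.isCeil_of_add hE.sharplyDominating hz hbM
      (by rw [add_comm, hab])).isHat
    obtain ⟨hbM, hT⟩ := (hE.unique_residual ⟨a, haM⟩ z hc b).1 hab
    exact ⟨⟨a, haM⟩, ⟨b, hbM⟩, ha, hb, hc, hT⟩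
  · rintro ⟨a, b, ha, hb, hc, hT⟩
    exact ⟨z.2, a, b, ha, hb, (hE.unique_residual a z hc b).2 ⟨b.2, hT⟩⟩

theorem isS_iff (x y : Mea E) (s : Sh E) : IsS x y s ↔
    (s : E) ∈ sharpSplit x y ∧ ∀ z : Sh E, (z : E) ∈ sharpSplit x y → (z : E) ≤ s :=
  ⟨fun H => ⟨H.1, fun _ hz => H.2 hz⟩, fun H => ⟨H.1, fun z hz => H.2 ⟨z, hz.1⟩ hz⟩⟩

variable {F : Type v} [EffectAlgebra F] (T : TripleIso E F)

theorem TripleIso.mem_h_iff (x : Mea E) (s : Sh E) :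
    T.meaEquiv x ∈ h (T.shEquiv s) ↔ x ∈ h s := by
  rw [← T.map_h, T.meaEquiv.injective.mem_set_image]

theorem TripleIso.sh_le_iff (hE : IsHomogeneous E) (hF : IsHomogeneous F) (s t : Sh E) :
    (T.shEquiv s : F) ≤ T.shEquiv t ↔ (s : E) ≤ t := by
  rw [hF.sh_le_iff, hE.sh_le_iff, T.shEquiv.surjective.exists]
  simp only [← T.sh_sum]

theorem TripleIso.mea_le_iff (x y : Mea E) :
    (T.meaEquiv x : F) ≤ T.meaEquiv y ↔ (x : E) ≤ y := by
  rw [EffectAlgebra.mea_le_iff, EffectAlgebra.mea_le_iff, T.meaEquiv.surjective.exists]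
  simp only [← T.mea_sum]

theorem TripleIso.isHat_iff (hE : IsTRT E) (hF : IsTRT F) (x : Mea E) (t : Sh E) :
    IsHat (T.meaEquiv x : F) (T.shEquiv t : F) ↔ IsHat (x : E) (t : E) := by
  rw [hF.sharplyDominating.isHat_mea_iff, hE.sharplyDominating.isHat_mea_iff,
    T.shEquiv.surjective.forall]
  simp only [T.mem_h_iff, T.sh_le_iff hE.homogeneous hF.homogeneous]

theorem TripleIso.isGLB_mea_iff (x y m : Mea E) :
    IsGLB {(T.meaEquiv x : F), (T.meaEquiv y : F)} (T.meaEquiv m : F) ↔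
      IsGLB {(x : E), (y : E)} (m : E) := by
  rw [EffectAlgebra.isGLB_mea_iff, EffectAlgebra.isGLB_mea_iff, T.meaEquiv.surjective.forall]
  simp only [T.mea_le_iff]

theorem TripleIso.isGLB_sh_mea_iff (s : Sh E) (x m : Mea E) :
    IsGLB {(T.shEquiv s : F), (T.meaEquiv x : F)} (T.meaEquiv m : F) ↔
      IsGLB {(s : E), (x : E)} (m : E) := by
  rw [EffectAlgebra.isGLB_sh_mea_iff, EffectAlgebra.isGLB_sh_mea_iff,
    T.meaEquiv.surjective.forall]
  simp only [T.mea_le_iff, T.mem_h_iff]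

theorem TripleIso.trtCondition_iff (hE : IsTRT E) (hF : IsTRT F) (x : Mea E) (t : Sh E)
    (y : Mea E) :
    TRTCondition (T.meaEquiv x) (T.shEquiv t) (T.meaEquiv y) ↔ TRTCondition x t y := by
  rw [EffectAlgebra.trtCondition_iff, EffectAlgebra.trtCondition_iff,
    T.meaEquiv.surjective.forall]
  simp only [T.meaEquiv.surjective.exists, T.isHat_iff hE hF, T.isGLB_mea_iff, ← T.mea_sum,
    T.mem_h_iff, T.mea_le_iff]

theorem TripleIso.mem_sharpSplit_iff (hE : IsTRT E) (hF : IsTRT F) (x y : Mea E) (z : Sh E) :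
    (T.shEquiv z : F) ∈ sharpSplit (T.meaEquiv x) (T.meaEquiv y) ↔
      (z : E) ∈ sharpSplit x y := by
  rw [hF.mem_sharpSplit_iff, hE.mem_sharpSplit_iff]
  simp only [T.meaEquiv.surjective.exists, T.isHat_iff hE hF, T.isGLB_sh_mea_iff,
    T.trtCondition_iff hE hF]

theorem TripleIso.isS_iff (hE : IsTRT E) (hF : IsTRT F) (x y : Mea E) (s : Sh E) :
    IsS (T.meaEquiv x) (T.meaEquiv y) (T.shEquiv s) ↔ IsS x y s := by
  rw [EffectAlgebra.isS_iff, EffectAlgebra.isS_iff, T.shEquiv.surjective.forall]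
  simp only [T.mem_sharpSplit_iff hE hF, T.sh_le_iff hE.homogeneous hF.homogeneous]

theorem TripleIso.map_shCompl (s : Sh E) : T.shEquiv (shCompl s) = shCompl (T.shEquiv s) := by
  refine Subtype.ext (eq_compl ?_)
  have h1 : SubSum (Sh E) s (shCompl s) ⟨1, one_mem_Sh⟩ := oplus_compl (s : E)
  have h2 : oplus (T.shEquiv s : F) (T.shEquiv (shCompl s) : F) =
    some (T.shEquiv ⟨1, one_mem_Sh⟩ : F) := (T.sh_sum _ _ _).1 h1
  rwa [T.map_one ⟨1, one_mem_Sh⟩ rfl] at h2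

/-- The bijection of the algebras of pairs induced by an isomorphism of triples. -/
def TripleIso.equivTea : Tea E ≃ Tea F where
  toFun p := ⟨T.shEquiv p.sharp, T.meaEquiv p.meager, by
    rw [← T.map_shCompl, T.mem_h_iff]; exact p.mem⟩
  invFun q := ⟨T.shEquiv.symm q.sharp, T.meaEquiv.symm q.meager, by
    rw [← T.mem_h_iff, T.map_shCompl, Equiv.apply_symm_apply, Equiv.apply_symm_apply]
    exact q.mem⟩
  left_inv p := Tea.ext' (congrArg _ (T.shEquiv.symm_apply_apply _))
    (congrArg _ (T.meaEquiv.symm_apply_apply _))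
  right_inv q := Tea.ext' (congrArg _ (T.shEquiv.apply_symm_apply _))
    (congrArg _ (T.meaEquiv.apply_symm_apply _))

theorem TripleIso.teaSum_iff (hE : IsTRT E) (hF : IsTRT F) (p q r : Tea E) :
    TeaSum (T.equivTea p) (T.equivTea q) (T.equivTea r) ↔ TeaSum p q r := by
  have h1 : ∀ p, (T.equivTea p).sharp = T.shEquiv p.sharp := fun _ => rfl
  have h2 : ∀ p, (T.equivTea p).meager = T.meaEquiv p.meager := fun _ => rfl
  simp only [TeaSum, h1, h2, T.shEquiv.surjective.exists, T.meaEquiv.surjective.exists,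
    T.isS_iff hE hF, T.isGLB_sh_mea_iff, ← T.mea_sum, ← T.sh_sum]

theorem TripleIso.exists_isIsomorphism {F : Type v} [EffectAlgebra F] (T : TripleIso E F)
    (hE : IsTRT E) (hF : IsTRT F) :
    ∃ e : E ≃ F, IsIsomorphism e := by
  refine ⟨(hE.equivTea.trans T.equivTea).trans hF.equivTea.symm,
    (isIsomorphism_iff _).2 fun x y z => ?_⟩
  rw [← hF.teaSum_iff, ← hE.teaSum_iff]
  simp only [Equiv.trans_apply, Equiv.apply_symm_apply]
  exact (T.teaSum_iff hE hF _ _ _).symm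

end TripleTransfer

end EffectAlgebra

theorem mainTheorem4 (E : Type u) [EffectAlgebra E]
    (hE : (EffectAlgebra.IsLatticeEA E ∧ EffectAlgebra.IsSharplyDominating E ∧
            EffectAlgebra.IsArchimedeanEA E ∧ EffectAlgebra.IsAtomicEA E) ∨
          (EffectAlgebra.IsHomogeneous E ∧ EffectAlgebra.IsOrthocomplete E) ∨
          EffectAlgebra.IsCompleteLatticeEA E) :
    -- `E` is a TRT-effect algebra
    EffectAlgebra.IsTRT E ∧
    -- `T(E)` is an effect algebra and `x ↦ (x̃, x ⊖ x̃)` is an isomorphism of `E` onto it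
    (∃ T : EffectAlgebra (EffectAlgebra.Tea E),
      (∀ p q r : EffectAlgebra.Tea E,
        T.oplus p q = some r ↔ EffectAlgebra.TeaSum p q r) ∧
      ((T.zero.sharp : E) = 0 ∧ (T.zero.meager : E) = 0) ∧
      ((T.one.sharp : E) = 1 ∧ (T.one.meager : E) = 0) ∧
      ∃ φ : E ≃ EffectAlgebra.Tea E,
        (∀ x : E, EffectAlgebra.IsTilde x ((φ x).sharp : E) ∧
          EffectAlgebra.oplus ((φ x).sharp : E) ((φ x).meager : E) = some x) ∧
        EffectAlgebra.IsIsomorphism φ) ∧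
    -- the triple characterizes `E` up to isomorphism within the class of TRT-effect algebras
    (∀ (F : Type v) [EffectAlgebra F], EffectAlgebra.IsTRT F →
      (Nonempty (EffectAlgebra.TripleIso E F) ↔
        ∃ e : E ≃ F, EffectAlgebra.IsIsomorphism e)) := by
  have hT : EffectAlgebra.IsTame E := by
    rcases hE with ⟨hL, hS, hA, hAt⟩ | ⟨hH, hO⟩ | hC
    · exact hL.isTame hS hA hAt
    · exact hH.isTame hO
    · exact hC.isLatticeEA.isHomogeneous.isTame hC.isOrthocomplete
  refine ⟨hT.isTRT, hT.isTRT.exists_effectAlgebra_tea, fun F _ hF => ⟨?_, ?_⟩⟩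
  · rintro ⟨T⟩
    exact T.exists_isIsomorphism hT.isTRT hF
  · rintro ⟨e, he⟩
    exact ⟨he.tripleIso⟩
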